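/- Let $k$ be a field and let $A$ be a Hopf algebra over $k$ with coproduct $\Delta(a)=\sum a_1\otimes a_2$, counit $\epsilon$ and antipode $S$ (not assumed bijective). Suppose that $A$ is AS-regular of global dimension $d$, that is: $A$ is left and right noetherian; the left module ${}_AA$ has injective dimension $d<\infty$, $\dim_k\mathrm{Ext}^d_A({}_Ak,{}_AA)=1$ and $\mathrm{Ext}^i_A({}_Ak,{}_AA)=0$ for all $i\neq d$, where $k=A/\ker\epsilon$ is the trivial module; the same conditions, with the same $d$, hold for right modules; and $\mathrm{gldim}\,A=d$. Let $\int^l=\mathrm{Ext}^d_A({}_Ak,{}_AA)$, a right $A$-module through the right action of $A$ on the second argument. For an $A$-bimodule $M$ on which $k$ acts centrally, let $H_n(A,M)$ be the Hochschild homology of $A$ with coefficients in $M$, and let $M'$ be the right $A$-module with underlying space $M$ and action $m\cdot a=\sum S(a_2)\,m\,a_1$. Then, for every such $M$ and every integer $i$, there is an isomorphism of $k$-vector spaces $$H_{d-i}(A,M)\;\cong\;\mathrm{Ext}^i_{A^{\mathrm{op}}}\bigl(\textstyle\int^l,M'\bigr),$$ where $H_n$ and $\mathrm{Ext}^n$ are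 zero for $n<0$, and $\mathrm{Ext}_{A^{\mathrm{op}}}$ is taken in the category of right $A$-modules. In particular, for every $k$-algebra automorphism $\sigma$ of $A$ and every integer $i$, $$H_{d-i}(A,{}^{\sigma}A)\;\cong\;\mathrm{Ext}^i_{A^{\mathrm{op}}}\bigl(\textstyle\int^l,({}^{\sigma}A)'\bigr),$$ where ${}^{\sigma}A$ is the bimodule $A$ with actions $a\cdot m\cdot b=\sigma(a)\,m\,b$. -/

import Mathlib

open CategoryTheory

universe u

noncomputable section

namespace HopfDuality

open scoped TensorProduct

/-! ### Hochschild homology with coefficients in a bimodule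

A bimodule over the `k`-algebra `A`, central over `k`, is a `k`-module `M` with commuting actions of
`A` and `Aᵐᵒᵖ`, both compatible with the action of `k`; the right action is
`m * a = MulOpposite.op a • m`. -/

section Hochschild

/-- The bimodule entry of the `i`-th face of `m ⊗ a₀ ⊗ ⋯ ⊗ aₙ`: it is `m a₀` for `i = 0`, it is
`aₙ m` for `i = n + 1`, and it is `m` otherwise. -/
def faceHead {A M : Type u} [Ring A] [AddCommGroup M] [Module A M] [Module Aᵐᵒᵖ M]
    {n : ℕ} (i : Fin (n + 2)) (m : M) (a : Fin (n + 1) → A) : M :=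
  if (i : ℕ) = 0 then MulOpposite.op (a 0) • m
  else if (i : ℕ) = n + 1 then a (Fin.last n) • m
  else m

/-- The algebra entries of the `i`-th face of `m ⊗ a₀ ⊗ ⋯ ⊗ aₙ`: they are `a₁, …, aₙ` for `i = 0`,
they are `a₀, …, aₙ₋₁` for `i = n + 1`, and they are `a₀, …, aᵢ₋₁ * aᵢ, …, aₙ` otherwise. -/
def faceTail {A : Type u} [Ring A] {n : ℕ} (i : Fin (n + 2)) (a : Fin (n + 1) → A) (j : Fin n) :
    A :=
  if (j : ℕ) + 1 < i then a j.castSucc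
  else if (j : ℕ) + 1 = i then a j.castSucc * a j.succ
  else a j.succ

variable {k A M : Type u} [Field k] [Ring A] [Algebra k A] [AddCommGroup M] [Module k M]
  [Module A M] [Module Aᵐᵒᵖ M] [IsScalarTower k A M] [IsScalarTower k Aᵐᵒᵖ M]

/-- Each argument enters a face linearly, in exactly one place. -/
theorem face_update {n : ℕ} (i : Fin (n + 2)) (m : M) (a : Fin (n + 1) → A) (p : Fin (n + 1)) :
    (∃ f : A →ₗ[k] M, ∀ x, faceHead i m (Function.update a p x) = f x ∧
      faceTail i (Function.update a p x) = faceTail i a) ∨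
    (∃ (q : Fin n) (f : A →ₗ[k] A), ∀ x,
      faceHead i m (Function.update a p x) = faceHead i m a ∧
      faceTail i (Function.update a p x) = Function.update (faceTail i a) q (f x)) := by
  have hi := i.isLt
  have hp := p.isLt
  by_cases h0 : (i : ℕ) = 0 ∧ (p : ℕ) = 0
  · left
    obtain ⟨h0, h1⟩ := h0
    have hp0 : p = 0 := Fin.ext h1
    subst hp0
    refine ⟨((Algebra.lsmul k k M : Aᵐᵒᵖ →ₐ[k] _).toLinearMap.flip m).comp
      (MulOpposite.opLinearEquiv k : A ≃ₗ[k] Aᵐᵒᵖ).toLinearMap, fun x => ⟨?_, ?_⟩⟩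
    · simp [faceHead, h0]
    · funext j
      simp [faceTail, h0]
  by_cases h1 : (i : ℕ) = n + 1 ∧ p = Fin.last n
  · left
    obtain ⟨h2, rfl⟩ := h1
    refine ⟨((Algebra.lsmul k k M : A →ₐ[k] _).toLinearMap.flip m), fun x => ⟨?_, ?_⟩⟩
    · simp [faceHead, h2]
    · funext j
      have : j.castSucc ≠ Fin.last n := (Fin.castSucc_lt_last j).ne
      simp [faceTail, h2, this]
  right
  have hhead : ∀ x, faceHead i m (Function.update a p x) = faceHead i m a := by
    intro x
    unfold faceHead
    split_ifs with h2 h3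
    · rw [Function.update_of_ne]
      intro h
      exact h0 ⟨h2, by simp [← h]⟩
    · rw [Function.update_of_ne]
      intro h
      exact h1 ⟨h3, h.symm⟩
    · rfl
  have hlast : (i : ℕ) = n + 1 → (p : ℕ) ≠ n := fun h h' => h1 ⟨h, Fin.ext h'⟩
  by_cases hpi : (p : ℕ) < i
  · have hpn : (p : ℕ) < n := by omega
    refine ⟨⟨p, hpn⟩, if (p : ℕ) + 1 = i then LinearMap.mulRight k (a ⟨p + 1, by omega⟩)
      else LinearMap.id, fun x => ⟨hhead x, ?_⟩⟩
    funext j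
    by_cases hj : j = ⟨p, hpn⟩
    · have e1 : j.castSucc = p := by rw [hj]; rfl
      have e2 : j.succ ≠ p := by intro h; rw [← e1] at h; simp [Fin.ext_iff] at h
      have e3 : j.succ = ⟨p + 1, by omega⟩ := by subst hj; rfl
      have e4 : (j : ℕ) = p := by rw [hj]
      rw [hj, Function.update_self, ← hj]
      simp only [faceTail, e1, e4, Function.update_self, Function.update_of_ne e2]
      split_ifs with c1 c2 c2
      · omega
      · simp
      · simp [e3]
      · omega
    · rw [Function.update_of_ne hj]
      have e1 : j.castSucc ≠ p := by
        intro h; apply hj; rw [Fin.ext_iff] at h ⊢; simpa using h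
      have e4 : (j : ℕ) ≠ p := fun h => hj (Fin.ext h)
      simp only [faceTail, Function.update_of_ne e1]
      split_ifs with c1 c2
      · rfl
      · rw [Function.update_of_ne]
        rw [Ne, Fin.ext_iff, Fin.val_succ]; omega
      · rw [Function.update_of_ne]
        rw [Ne, Fin.ext_iff, Fin.val_succ]; omega
  · have hp1 : 1 ≤ (p : ℕ) := by omega
    refine ⟨⟨p - 1, by omega⟩, if (p : ℕ) = i then LinearMap.mulLeft k (a ⟨p - 1, by omega⟩)
      else LinearMap.id, fun x => ⟨hhead x, ?_⟩⟩
    funext j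
    by_cases hj : j = ⟨p - 1, by omega⟩
    · have e4 : (j : ℕ) = p - 1 := by rw [hj]
      have e1 : j.succ = p := by rw [Fin.ext_iff, Fin.val_succ]; omega
      have e2 : j.castSucc ≠ p := by intro h; rw [← e1] at h; simp [Fin.ext_iff] at h
      have e3 : j.castSucc = ⟨p - 1, by omega⟩ := by subst hj; rfl
      rw [hj, Function.update_self, ← hj]
      simp only [faceTail, e1, Function.update_self, Function.update_of_ne e2]
      split_ifs with c1 c2 c2
      · omega
      · omega
      · simp [e3]
      · omega
      · omega
      · simp
    · rw [Function.update_of_ne hj]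
      have e4 : (j : ℕ) ≠ p - 1 := fun h => hj (Fin.ext h)
      have e1 : j.succ ≠ p := by rw [Ne, Fin.ext_iff, Fin.val_succ]; omega
      simp only [faceTail, Function.update_of_ne e1]
      split_ifs with c1 c2
      · rw [Function.update_of_ne]
        rw [Ne, Fin.ext_iff, Fin.val_castSucc]; omega
      · rw [Function.update_of_ne]
        rw [Ne, Fin.ext_iff, Fin.val_castSucc]; omega
      · rfl

variable (k A M)

/-- The Hochschild chains `M ⊗ A ⊗ ⋯ ⊗ A` of degree `n` (with `n` factors `A`). -/
abbrev HochschildChain (n : ℕ) : Type u := M ⊗[k] PiTensorProduct k (fun _ : Fin n => A)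

/-- The multilinear map `(a₀, …, aₙ) ↦ dᵢ (m ⊗ a₀ ⊗ ⋯ ⊗ aₙ)`. -/
def faceMultilinear {n : ℕ} (i : Fin (n + 2)) (m : M) :
    MultilinearMap k (fun _ : Fin (n + 1) => A) (HochschildChain k A M n) where
  toFun a := faceHead i m a ⊗ₜ[k] PiTensorProduct.tprod k (faceTail i a)
  map_update_add' {inst} a p x y := by
    obtain rfl : inst = instDecidableEqFin (n + 1) := Subsingleton.elim _ _
    obtain ⟨f, hf⟩ | ⟨q, f, hf⟩ := face_update (k := k) i m a p
    · simp only [(hf _).1, (hf _).2, map_add, TensorProduct.add_tmul]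
    · simp only [(hf _).1, (hf _).2, map_add, MultilinearMap.map_update_add,
        TensorProduct.tmul_add]
  map_update_smul' {inst} a p c x := by
    obtain rfl : inst = instDecidableEqFin (n + 1) := Subsingleton.elim _ _
    obtain ⟨f, hf⟩ | ⟨q, f, hf⟩ := face_update (k := k) i m a p
    · simp only [(hf _).1, (hf _).2, map_smul, TensorProduct.smul_tmul']
    · simp only [(hf _).1, (hf _).2, map_smul, MultilinearMap.map_update_smul,
        TensorProduct.tmul_smul]

/-- The `i`-th face map `dᵢ` of the Hochschild complex. -/
def face {n : ℕ} (i : Fin (n + 2)) : HochschildChain k A M (n + 1) →ₗ[k] HochschildChain k A M n :=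
  TensorProduct.lift
    { toFun := fun m => PiTensorProduct.lift (faceMultilinear k A M i m)
      map_add' := fun m m' => by
        ext a
        simp only [faceMultilinear, faceHead, LinearMap.compMultilinearMap_apply,
          PiTensorProduct.lift.tprod, MultilinearMap.coe_mk, LinearMap.add_apply]
        split_ifs <;> simp [TensorProduct.add_tmul]
      map_smul' := fun c m => by
        ext a
        simp only [faceMultilinear, faceHead, LinearMap.compMultilinearMap_apply,
          PiTensorProduct.lift.tprod, MultilinearMap.coe_mk, LinearMap.smul_apply,
          RingHom.id_apply]
        split_ifs <;> simp [TensorProduct.smul_tmul', smul_comm _ c] }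

variable {k A M}

theorem face_tmul_tprod {n : ℕ} (i : Fin (n + 2)) (m : M) (a : Fin (n + 1) → A) :
    face k A M i (m ⊗ₜ PiTensorProduct.tprod k a) =
      faceHead i m a ⊗ₜ PiTensorProduct.tprod k (faceTail i a) := by
  simp [face, faceMultilinear]

variable [SMulCommClass A Aᵐᵒᵖ M]

theorem faceHead_faceHead {A M : Type u} [Ring A] [AddCommGroup M] [Module A M] [Module Aᵐᵒᵖ M]
    [SMulCommClass A Aᵐᵒᵖ M] {n : ℕ} (i j : Fin (n + 2)) (hij : (i : ℕ) ≤ j) (m : M)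
    (a : Fin (n + 2) → A) :
    faceHead i (faceHead j.succ m a) (faceTail j.succ a) =
      faceHead j (faceHead i.castSucc m a) (faceTail i.castSucc a) := by
  have hi := i.isLt
  have hj := j.isLt
  have e1 : (0 : Fin (n + 1)).castSucc = (0 : Fin (n + 2)) := rfl
  have e2 : (Fin.last n).succ = Fin.last (n + 1) := rfl
  simp only [faceHead, faceTail, Fin.val_succ, Fin.val_castSucc, Fin.val_last, Fin.val_zero, e1, e2,
    Nat.succ_ne_zero, if_false, Nat.add_right_cancel_iff]
  by_cases hi0 : (i : ℕ) = 0
  · by_cases hj0 : (j : ℕ) = 0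
    · have h1 : ¬ ((j : ℕ) = n + 1) := by omega
      simp [hi0, hj0, mul_smul]
    · by_cases hjn : (j : ℕ) = n + 1
      · simp [hi0, hjn, smul_comm (a (Fin.last (n + 1)))]
      · have h3 : 0 < (j : ℕ) := by omega
        simp [hi0, hj0, hjn, h3]
  · have hj0 : ¬ (j : ℕ) = 0 := by omega
    have h4 : ¬ (i : ℕ) = n + 2 := by omega
    by_cases hjn : (j : ℕ) = n + 1
    · by_cases hin : (i : ℕ) = n + 1
      · simp [hjn, hin, mul_smul]
      · have h5 : ¬ n + 1 < (i : ℕ) := by omega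
        have h6 : ¬ n + 1 = (i : ℕ) := by omega
        simp [hi0, hjn, hin, h4, h5, h6]
    · have hin : ¬ (i : ℕ) = n + 1 := by omega
      simp [hi0, hj0, hjn, hin, h4]

/-- The simplicial identity `dᵢ dⱼ₊₁ = dⱼ dᵢ` for `i ≤ j`. -/
theorem face_comp_face {n : ℕ} (i j : Fin (n + 2)) (hij : (i : ℕ) ≤ j) :
    (face k A M i).comp (face k A M j.succ) =
      (face k A M j).comp (face k A M (i.castSucc)) := by
  have hi := i.isLt
  have hj := j.isLt
  apply TensorProduct.ext'
  intro m t
  induction t using PiTensorProduct.induction_on with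
  | add x y hx hy => rw [TensorProduct.tmul_add, map_add, map_add, hx, hy]
  | smul_tprod r a =>
    rw [TensorProduct.tmul_smul, map_smul, map_smul]
    congr 1
    simp only [LinearMap.comp_apply, face_tmul_tprod]
    congr 1
    · exact faceHead_faceHead i j hij m a
    · congr 1
      funext l
      simp only [faceTail, Fin.val_succ, Fin.val_castSucc, Fin.succ_castSucc]
      split_ifs <;> first | rfl | omega | exact mul_assoc _ _ _ | exact (mul_assoc _ _ _).symm

variable (k A M)

/-- The Hochschild differential `∑ᵢ (-1)ⁱ dᵢ`. -/
def hochschildD (n : ℕ) : HochschildChain k A M (n + 1) →ₗ[k] HochschildChain k A M n :=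
  ∑ i : Fin (n + 2), (-1 : ℤ) ^ (i : ℕ) • face k A M i

theorem hochschildD_comp (n : ℕ) :
    (hochschildD k A M n).comp (hochschildD k A M (n + 1)) = 0 := by
  have key : (hochschildD k A M n).comp (hochschildD k A M (n + 1)) =
      ∑ p : Fin (n + 2) × Fin (n + 3),
        (-1 : ℤ) ^ ((p.1 : ℕ) + p.2) • (face k A M p.1).comp (face k A M p.2) := by
    rw [Fintype.sum_prod_type]
    ext x
    simp [hochschildD, LinearMap.sum_apply, Finset.smul_sum, pow_add, mul_smul]
  rw [key]
  let S : Finset (Fin (n + 2) × Fin (n + 3)) := {p | (p.2 : ℕ) ≤ p.1}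
  rw [← Finset.sum_add_sum_compl S, ← eq_neg_iff_add_eq_zero, ← Finset.sum_neg_distrib]
  refine Finset.sum_bij (fun p hp => (p.2.castLT (lt_of_le_of_lt (Finset.mem_filter.mp hp).2
    p.1.isLt), p.1.succ)) ?_ ?_ ?_ ?_
  · rintro ⟨i, j⟩ hp
    simp only [S, Finset.compl_filter, Finset.mem_filter_univ, Fin.val_succ,
      Fin.val_castLT] at hp ⊢
    omega
  · rintro ⟨i, j⟩ hp ⟨i', j'⟩ hp' h
    simp only [Prod.mk.injEq, Fin.ext_iff, Fin.val_succ, Fin.val_castLT] at h ⊢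
    omega
  · rintro ⟨i, j⟩ hp
    simp only [S, Finset.compl_filter, Finset.mem_filter_univ, not_le] at hp
    have hj := j.isLt
    refine ⟨(⟨j - 1, by omega⟩, i.castSucc), ?_, ?_⟩
    · rw [Finset.mem_filter_univ]
      change (i : ℕ) ≤ j - 1
      omega
    · refine Prod.ext (Fin.ext rfl) (Fin.ext ?_)
      change (j : ℕ) - 1 + 1 = j
      omega
  · rintro ⟨i, j⟩ hp
    have hp' : (j : ℕ) ≤ i := (Finset.mem_filter.mp hp).2
    have h := face_comp_face (k := k) (A := A) (M := M)
      (j.castLT (lt_of_le_of_lt hp' i.isLt)) i hp'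
    dsimp only
    rw [h, ← neg_smul, Fin.castSucc_castLT]
    congr 1
    simp only [Fin.val_succ, Fin.val_castLT]
    ring

/-- The Hochschild complex of the algebra `A` with coefficients in the bimodule `M`. -/
def hochschildComplex : ChainComplex (ModuleCat.{u} k) ℕ :=
  ChainComplex.of (fun n => ModuleCat.of k (HochschildChain k A M n))
    (fun n => ModuleCat.ofHom (hochschildD k A M n))
    (fun n => by rw [← ModuleCat.ofHom_comp, hochschildD_comp]; rfl)

/-- The Hochschild homology `H_n(A, M)` for every integer `n`, zero in negative degrees. -/
def hochschildHomology : ℤ → ModuleCat.{u} k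
  | Int.ofNat n => (hochschildComplex k A M).homology n
  | Int.negSucc _ => ModuleCat.of k PUnit

end Hochschild

/-! ### The right adjoint action and left twists of bimodules -/

section Adjoint

variable (k A M : Type u) [Field k] [Ring A] [HopfAlgebra k A] [AddCommGroup M] [Module k M]
  [Module A M] [Module Aᵐᵒᵖ M] [IsScalarTower k A M] [IsScalarTower k Aᵐᵒᵖ M]
  [SMulCommClass A Aᵐᵒᵖ M]

/-- The algebra map `A ⊗ A → End(M)ᵐᵒᵖ` with `b ⊗ c ↦ (m ↦ S(c) m b)`. -/
def adjointAux : A ⊗[k] A →ₐ[k] (Module.End k M)ᵐᵒᵖ :=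
  Algebra.TensorProduct.lift
    (AlgHom.opComm.symm (Algebra.lsmul k k M : Aᵐᵒᵖ →ₐ[k] Module.End k M))
    ((AlgHom.op (Algebra.lsmul k k M : A →ₐ[k] Module.End k M)).comp
      (HopfAlgebra.antipodeAlgHomOp k A))
    (fun b c => by
      apply MulOpposite.unop_injective
      ext m
      simp only [MulOpposite.unop_mul, Module.End.mul_apply]
      exact (smul_comm (HopfAlgebra.antipode k c) (MulOpposite.op b) m))

/-- The map `a ↦ (m ↦ ∑ S(a₂) m a₁)`. -/
def adjointHom : Aᵐᵒᵖ →ₐ[k] Module.End k M :=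
  AlgHom.opComm ((adjointAux k A M).comp (Bialgebra.comulAlgHom k A))

/-- The right adjoint module `M'` of a bimodule `M`: the space `M` with the right action
`m * a = ∑ S(a₂) m a₁`, where `Δ(a) = ∑ a₁ ⊗ a₂`. -/
@[nolint unusedArguments]
def RightAdjoint (_k _A M : Type u) : Type u := M

instance : AddCommGroup (RightAdjoint k A M) := inferInstanceAs (AddCommGroup M)

instance : Module Aᵐᵒᵖ (RightAdjoint k A M) :=
  Module.compHom (R := Module.End k M) M (adjointHom k A M).toRingHom

theorem rightAdjoint_smul {k A M : Type u} [Field k] [Ring A] [HopfAlgebra k A] [AddCommGroup M]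
    [Module k M] [Module A M] [Module Aᵐᵒᵖ M] [IsScalarTower k A M] [IsScalarTower k Aᵐᵒᵖ M]
    [SMulCommClass A Aᵐᵒᵖ M] {ι : Type*} (a : A) (r : Coalgebra.Repr k a ι) (m : M) :
    (show M from (MulOpposite.op a • (show RightAdjoint k A M from m))) =
      ∑ i ∈ r.index, HopfAlgebra.antipode k (r.right i) • MulOpposite.op (r.left i) • m := by
  change adjointHom k A M (MulOpposite.op a) m = _
  have h : Coalgebra.comul a = ∑ i ∈ r.index, r.left i ⊗ₜ[k] r.right i := r.eq.symm
  simp only [adjointHom, adjointAux, AlgHom.opComm_apply_apply, AlgHom.comp_apply, Bialgebra.comulAlgHom_apply, MulOpposite.unop_op, h, map_sum]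
  rw [Finset.unop_sum, LinearMap.sum_apply]
  refine Finset.sum_congr rfl fun i _ => ?_
  exact congrArg (fun φ : (Module.End k M)ᵐᵒᵖ => φ.unop m)
    (Algebra.TensorProduct.lift_tmul _ _ _ (r.left i) (r.right i))

end Adjoint

section Twist

variable {k A : Type u} [Field k] [Ring A] [Algebra k A]

/-- The bimodule `^σ M`: the right module `M` with the left action `a * m = σ(a) m`. -/
@[nolint unusedArguments]
def LeftTwist (_σ : A ≃ₐ[k] A) (M : Type u) : Type u := M

variable (σ : A ≃ₐ[k] A) (M : Type u) [AddCommGroup M] [Module k M]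
  [Module A M] [Module Aᵐᵒᵖ M] [IsScalarTower k A M] [IsScalarTower k Aᵐᵒᵖ M]
  [SMulCommClass A Aᵐᵒᵖ M]

instance : AddCommGroup (LeftTwist σ M) := inferInstanceAs (AddCommGroup M)
instance : Module k (LeftTwist σ M) := inferInstanceAs (Module k M)
instance : Module A (LeftTwist σ M) := Module.compHom M σ.toRingEquiv.toRingHom
instance : Module Aᵐᵒᵖ (LeftTwist σ M) := inferInstanceAs (Module Aᵐᵒᵖ M)
instance : IsScalarTower k Aᵐᵒᵖ (LeftTwist σ M) := inferInstanceAs (IsScalarTower k Aᵐᵒᵖ M)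
instance : IsScalarTower k A (LeftTwist σ M) where
  smul_assoc c a m := by
    change (show M from σ (c • a) • (show M from m)) = c • (σ a • (show M from m))
    rw [map_smul, smul_assoc]
instance : SMulCommClass A Aᵐᵒᵖ (LeftTwist σ M) where
  smul_comm a b m := smul_comm (σ a) b (show M from m)

end Twist

/-! ### Artin-Schelter regular algebras and their homological integrals -/

section ArtinSchelter

open Abelian

/-- The (left) global dimension of a ring. -/
def globalDimension (A : Type u) [Ring A] : WithBot ℕ∞ :=
  ⨆ X : ModuleCat.{u} A, projectiveDimension X

variable {k A : Type u} [Field k] [Ring A] [Algebra k A]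

/-- The trivial left module `k = A / ker ε` of an algebra with augmentation `ε`. -/
@[nolint unusedArguments]
def TrivialModule (_ε : A →ₐ[k] k) : Type u := k

variable (ε : A →ₐ[k] k)

instance : AddCommGroup (TrivialModule ε) := inferInstanceAs (AddCommGroup k)
instance : Module A (TrivialModule ε) := Module.compHom k ε.toRingHom

/-- The space `Ext^i_A(k, A)`, for the trivial and the regular left `A`-modules. -/
abbrev TrivialExt (i : ℕ) : Type u :=
  Ext (ModuleCat.of A (TrivialModule ε)) (ModuleCat.of A A) i

/-- The conditions (AS1) and (AS2) for left modules. -/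
structure IsLeftASGorenstein (d : ℕ) : Prop where
  injdim : injectiveDimension (ModuleCat.of A A) = d
  finrank_ext : Module.finrank k (TrivialExt ε d) = 1
  ext_eq_zero : ∀ i : ℕ, i ≠ d → Subsingleton (TrivialExt ε i)

/-- The augmentation of the opposite algebra; left modules over `Aᵐᵒᵖ` are right `A`-modules. -/
def opAugmentation : Aᵐᵒᵖ →ₐ[k] k := ε.fromOpposite (fun _ _ => Commute.all _ _)

/-- An augmented algebra is Artin-Schelter Gorenstein of injective dimension `d`. -/
structure IsASGorenstein (d : ℕ) : Prop where
  noetherian_left : IsNoetherianRing A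
  noetherian_right : IsNoetherianRing Aᵐᵒᵖ
  left : IsLeftASGorenstein ε d
  right : IsLeftASGorenstein (opAugmentation ε) d

/-- An augmented algebra is Artin-Schelter regular of global dimension `d`. -/
structure IsASRegular (d : ℕ) : Prop extends IsASGorenstein ε d where
  gldim : globalDimension A = d

/-- The endomorphism `x ↦ x * a` of the left regular module. -/
def rightMul (a : A) : ModuleCat.of A A ⟶ ModuleCat.of A A :=
  ModuleCat.ofHom (LinearMap.toSpanSingleton A A a)

/-- The space `∫^l = Ext^d_A(k, A)` of left homological integrals. -/
def LeftIntegral (d : ℕ) : Type u := TrivialExt ε d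

instance (d : ℕ) : AddCommGroup (LeftIntegral ε d) := inferInstanceAs (AddCommGroup (Ext _ _ d))

/-- The right action of `A` on `∫^l` that is induced by the right action of `A` on the second
argument of `Ext^d_A(k, A)`. -/
instance (d : ℕ) : Module Aᵐᵒᵖ (LeftIntegral ε d) where
  smul a e := Ext.comp (show TrivialExt ε d from e) (Ext.mk₀ (rightMul a.unop)) (add_zero d)
  one_smul e := by
    change Ext.comp _ (Ext.mk₀ (rightMul 1)) _ = _
    have : rightMul (1 : A) = 𝟙 _ := by
      ext; simp [rightMul]
    rw [this, Ext.comp_mk₀_id]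
  mul_smul a b e := by
    change Ext.comp _ (Ext.mk₀ (rightMul (b.unop * a.unop))) _ =
      Ext.comp (Ext.comp _ (Ext.mk₀ (rightMul b.unop)) _) (Ext.mk₀ (rightMul a.unop)) _
    have : rightMul (b.unop * a.unop) = rightMul b.unop ≫ rightMul a.unop := by
      ext; simp [rightMul]
    rw [Ext.comp_assoc_of_third_deg_zero, Ext.mk₀_comp_mk₀, this]
  smul_zero a := Ext.zero_comp _ _ _ _ (add_zero d)
  smul_add a e f := Ext.add_comp _ _ _ _
  add_smul a b e := by
    change Ext.comp _ (Ext.mk₀ (rightMul (a.unop + b.unop))) _ = _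
    have : rightMul (a.unop + b.unop) = rightMul a.unop + rightMul b.unop := by
      ext; simp [rightMul]
    rw [this, Ext.mk₀_add, Ext.comp_add]
    rfl
  zero_smul e := by
    change Ext.comp _ (Ext.mk₀ (rightMul 0)) _ = _
    have : rightMul (0 : A) = 0 := by
      ext; simp [rightMul]
    rw [this, Ext.mk₀_zero, Ext.comp_zero]
    rfl

/-- The vector space `Ext^i_A(X, Y)` for every integer `i`, zero for negative `i`. -/
def extModule (k : Type u) {A : Type u} [Field k] [Ring A] [Algebra k A] (X Y : ModuleCat.{u} A) :
    ℤ → ModuleCat.{u} k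
  | Int.ofNat i => ModuleCat.of k (Ext X Y i)
  | Int.negSucc _ => ModuleCat.of k PUnit

end ArtinSchelter

end HopfDuality

end

/-! For t = a₁ ⊗ ⋯ ⊗ aₙ apply Δ to every entry, keep the first legs as a tensor t' and multiply the
second legs to an element t'' = a₁''⋯aₙ''. The map m ⊗ t ↦ ∑ t''m ⊗ t' carries the Hochschild
complex of M to that of M' with A acting from the left through ε. It respects each face
(`face_twistEquiv`): for the zeroth one ∑ S(a₂)a₃ ⊗ a₁ = 1 ⊗ a turns the adjoint action back into
the right action, the inner ones only need Δ to be multiplicative, and for the last one ∑ ε(a')a'' =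
a restores the left action. Maps of this shape form an action of the convolution algebra Hom(A, End
M) on the chains (`twist_twist`), and the left action composed with S is a convolution inverse of
the left action. So the map is bijective, without any invertibility of S.

For a trivial left action the Hochschild complex is M' ⊗_A B, where B is the bar resolution of k
(`tensorBarIso`). Hence H_n(A, M) = Tor_n(M', k), and B may be replaced by any projective
resolution. Noetherianity and the bound on global dimension provide a resolution P of length d by
finitely generated projectives (`IsASRegular.exists_resolution`).

The cohomology of Hom_A(P, A) is Ext(k, A), which is concentrated in degree d. Read backwards,
Hom_A(P, A) is therefore a projective resolution of ∫^l by right modules (`integralResolution`).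
Finite generation and projectivity give natural isomorphisms M' ⊗_A P_n ≅ Hom(Hom_A(P_n, A), M')
(`tensorEval_bijective`), so M' ⊗_A P is the complex of maps from that resolution to M', with degree
n matched to degree d - n (`nonempty_homology_iso_ext`). For i outside [0, d] both sides vanish,
since both resolutions have length d. -/

noncomputable section

namespace HopfDuality

open Abelian

open scoped TensorProduct

/-! ### Projective resolutions from elementwise exactness; finite resolutions -/

section Resolution

variable {R : Type u} [Ring R]

/-- A chain complex of projective modules which is exact in positive degrees and has cokernel `X`
is a projective resolution of `X`. -/
def resolutionOfExact (C : ChainComplex (ModuleCat.{u} R) ℕ) {X : ModuleCat.{u} R} (p : C.X 0 ⟶ X)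
    (hproj : ∀ n, Projective (C.X n)) (hp : Function.Surjective p)
    (w : C.d 1 0 ≫ p = 0) (h0 : ∀ x, p x = 0 → ∃ y, C.d 1 0 y = x)
    (hs : ∀ n x, C.d (n + 1) n x = 0 → ∃ y, C.d (n + 2) (n + 1) y = x) :
    ProjectiveResolution X where
  complex := C
  projective := hproj
  π := (ChainComplex.toSingle₀Equiv _ _).symm ⟨p, w⟩
  quasiIso := ⟨fun n => by
    cases n
    · rw [ChainComplex.quasiIsoAt₀_iff, ShortComplex.quasiIso_iff_of_zeros']
      · refine (ShortComplex.exact_and_epi_g_iff_of_iso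
          (S₁ := ShortComplex.mk (C.d 1 0) p w) ?_).1 ⟨?_, ?_⟩
        · exact ShortComplex.isoMk (Iso.refl _) (Iso.refl _) (Iso.refl _)
            ((Category.id_comp _).trans (Category.comp_id _).symm)
            ((Category.id_comp _).trans (Category.comp_id _).symm)
        · rw [ShortComplex.moduleCat_exact_iff]
          exact h0
        · exact (ModuleCat.epi_iff_surjective _).2 hp
      · exact C.shape 0 0 (by simp)
      · rfl
      · rfl
    · rw [quasiIsoAt_iff_exactAt']
      · rw [HomologicalComplex.exactAt_iff' _ (_ + 2) (_ + 1) _ (by simp only [ChainComplex.prev]; rfl) (by simp; rfl),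
          ShortComplex.moduleCat_exact_iff]
        exact hs _
      · apply ChainComplex.exactAt_succ_single_obj⟩

/-- First isomorphism theorem: homology may be read off from any surjection on cycles whose kernel
is the boundaries. -/
theorem nonempty_homology_iso {k : Type u} [Field k] (S : ShortComplex (ModuleCat.{u} k))
    {E : Type u} [AddCommGroup E] [Module k E] (θ : LinearMap.ker S.g.hom →ₗ[k] E)
    (hθ : Function.Surjective θ) (hker : ∀ z, θ z = 0 ↔ ∃ y, S.f y = z.1) :
    Nonempty (S.homology ≅ ModuleCat.of k E) := by
  refine ⟨S.moduleCatHomologyIso ≪≫ LinearEquiv.toModuleIso (X₁ := _ ⧸ LinearMap.range S.moduleCatToCycles) ?_⟩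
  refine (Submodule.quotEquivOfEq _ _ ?_).trans (θ.quotKerEquivOfSurjective hθ)
  ext z
  rw [LinearMap.mem_ker, hker, LinearMap.mem_range]
  refine exists_congr fun y => ?_
  rw [Subtype.ext_iff]
  rfl

end Resolution

section FiniteResolution

variable {A : Type u} [Ring A]

/-- A finitely generated module of projective dimension at most `d` over a noetherian ring has a
resolution of length `d` by finitely generated projective modules. -/
theorem exists_finite_complex [IsNoetherianRing A] (d : ℕ) (X : ModuleCat.{u} A)
    (hX : Module.Finite A X) (hd : HasProjectiveDimensionLE X d) :
    ∃ (C : ChainComplex (ModuleCat.{u} A) ℕ) (p : C.X 0 ⟶ X) (_ : C.d 1 0 ≫ p = 0),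
      (∀ n, Projective (C.X n)) ∧ (∀ n, Module.Finite A (C.X n)) ∧
      (∀ n, d < n → Limits.IsZero (C.X n)) ∧ Function.Surjective p ∧
      (∀ x, p x = 0 → ∃ y, C.d 1 0 y = x) ∧
      ∀ n x, C.d (n + 1) n x = 0 → ∃ y, C.d (n + 2) (n + 1) y = x := by
  induction d generalizing X with
  | zero =>
    have hP : Projective X := (projective_iff_hasProjectiveDimensionLE_zero X).2 hd
    refine ⟨(ChainComplex.single₀ _).obj X, 𝟙 X, Limits.zero_comp, ?_, ?_, ?_, ?_, ?_, ?_⟩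
    · exact (ProjectiveResolution.self X).projective
    · rintro (_ | n)
      · exact hX
      · have := ModuleCat.subsingleton_of_isZero
          (HomologicalComplex.isZero_single_obj_X (ComplexShape.down ℕ) 0 X (n + 1) (by simp))
        infer_instance
    · intro n hn
      exact HomologicalComplex.isZero_single_obj_X (ComplexShape.down ℕ) 0 X n (by omega)
    · exact fun x => ⟨x, rfl⟩
    · exact fun x hx => ⟨0, (map_zero _).trans hx.symm⟩
    · intro n x _
      have := ModuleCat.subsingleton_of_isZero
          (HomologicalComplex.isZero_single_obj_X (ComplexShape.down ℕ) 0 X (n + 1) (by simp))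
      exact ⟨0, Subsingleton.elim _ _⟩
  | succ d ih =>
    -- Dimension shifting: the kernel of a surjection from a finite free module is finitely
    -- generated because A is noetherian, and its projective dimension drops by one. Its resolution
    -- is spliced with the free module in degree 0.
    obtain ⟨n, f, hf⟩ := Module.Finite.exists_fin' A X
    have hF : Projective (ModuleCat.of A (Fin n → A)) :=
      ModuleCat.projective_of_categoryTheory_projective _
    have hS := LinearMap.shortExact_shortComplexKer hf
    have hK : HasProjectiveDimensionLE (ModuleCat.of A (LinearMap.ker f)) d :=
      (hS.hasProjectiveDimensionLT_X₃_iff d hF).1 hd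
    obtain ⟨C, p, w, hproj, hfin, hzero, hp, h0, hs⟩ :=
      ih (ModuleCat.of A (LinearMap.ker f)) inferInstance hK
    let q : C.X 0 ⟶ ModuleCat.of A (Fin n → A) := p ≫ ModuleCat.ofHom (LinearMap.ker f).subtype
    have hq : C.d 1 0 ≫ q = 0 := by rw [reassoc_of% w, Limits.zero_comp]
    have hq0 : ∀ x, q x = 0 → p x = 0 := fun x hx => Subtype.ext hx
    refine ⟨C.augment q hq, ModuleCat.ofHom f, ?_, ?_, ?_, ?_, hf, ?_, ?_⟩
    · ext x
      exact (p x).2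
    · rintro (_ | m)
      · exact hF
      · exact hproj m
    · rintro (_ | m)
      · change Module.Finite A (Fin n → A)
        infer_instance
      · exact hfin m
    · rintro (_ | m) hm
      · omega
      · exact hzero m (by omega)
    · intro x hx
      obtain ⟨y, hy⟩ := hp ⟨x, hx⟩
      exact ⟨y, congrArg Subtype.val hy⟩
    · rintro (_ | m) x hx
      · exact h0 x (hq0 x hx)
      · exact hs m x hx

end FiniteResolution

/-! ### Ext classes as cocycles on a projective resolution -/

section ExtMk

variable {C : Type*} [Category C] [Abelian C] [HasExt C] {X Y : C} (R : ProjectiveResolution X)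

-- Ext consists of cohomology classes of maps from the resolution, seen as a cochain complex in
-- nonpositive integer degrees, so a class vanishes exactly when its cocycle is a coboundary. With
-- integer indices no degree is special: for n = 0 the map g starts at the zero object in degree 1.
open CochainComplex.HomComplex in
theorem extMk_cochain_eq_zero_iff (n : ℕ) (m m' m'' : ℤ) (hn : -(n : ℤ) = m) (hm' : m' + 1 = m)
    (hm'' : m + 1 = m'') (f : R.cochainComplex.X m ⟶ Y) (hf : R.cochainComplex.d m' m ≫ f = 0)
    (hf' : R.complex.d (n + 1) n ≫ (R.cochainComplexXIso m n hn).inv ≫ f = 0) :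
    R.extMk ((R.cochainComplexXIso m n hn).inv ≫ f) (n + 1) rfl hf' = 0 ↔
      ∃ g : R.cochainComplex.X m'' ⟶ Y, R.cochainComplex.d m m'' ≫ g = f := by
  subst hn
  simp only [← R.extEquivCohomologyClass.apply_eq_iff_eq,
    ProjectiveResolution.extEquivCohomologyClass_extMk,
    ProjectiveResolution.extEquivCohomologyClass_zero,
    CohomologyClass.mk_eq_zero_iff]
  rw [Cocycle.toSingleMk_mem_coboundaries_iff _ _ _ _ _ m'' hm'']
  simp

/-- The resolution is zero in cohomological degree 1, so the only coboundary is 0. -/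
theorem extMk_zero_eq_zero_iff (f : R.complex.X 0 ⟶ Y) (hf : R.complex.d 1 0 ≫ f = 0) :
    R.extMk f 1 rfl hf = 0 ↔ f = 0 := by
  refine ⟨fun h => ?_, fun h => by subst h; simp⟩
  rw [← Iso.inv_hom_id_assoc (R.cochainComplexXIso (-(0 : ℕ)) 0 rfl) f] at hf
  have h' := (extMk_cochain_eq_zero_iff R 0 _ (-1) 1 rfl rfl rfl
    ((R.cochainComplexXIso (-(0 : ℕ)) 0 rfl).hom ≫ f)
    (by rw [R.cochainComplex_d (-1) _ 1 0 rfl rfl]; simpa using hf) hf).1 (by simpa using h)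
  obtain ⟨g, hg⟩ := h'
  have h0 : g = 0 := (CochainComplex.isZero_of_isStrictlyLE R.cochainComplex 0 1).eq_of_src _ _
  rw [← cancel_epi (R.cochainComplexXIso (-(0 : ℕ)) 0 rfl).hom, ← hg, h0]
  simp

/-- Vanishing of Ext in one degree is exactness of the complex Hom(R, Y) at that spot; this is what
makes the dual of a resolution exact. -/
theorem exists_comp_eq_of_subsingleton_ext {n : ℕ} (hn : Subsingleton (Ext X Y n)) (m m' m'' : ℤ)
    (hm : -(n : ℤ) = m) (hm' : m' + 1 = m) (hm'' : m + 1 = m'') (f : R.cochainComplex.X m ⟶ Y)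
    (hf : R.cochainComplex.d m' m ≫ f = 0) :
    ∃ g : R.cochainComplex.X m'' ⟶ Y, R.cochainComplex.d m m'' ≫ g = f := by
  refine (extMk_cochain_eq_zero_iff R n m m' m'' hm hm' hm'' f hf ?_).1 (hn.elim _ _)
  rw [R.cochainComplex_d m' m (n + 1) n (by omega) hm, Category.assoc, Category.assoc] at hf
  exact (cancel_epi _).1 (hf.trans Limits.comp_zero.symm)

theorem smul_extMk {k : Type*} [Ring k] [Linear k C] {n : ℕ} (c : k) (f : R.complex.X n ⟶ Y)
    (m : ℕ) (hm : n + 1 = m) (hf : R.complex.d m n ≫ f = 0) :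
    c • R.extMk f m hm hf = R.extMk (c • f) m hm (by simp [hf]) := by
  rw [Ext.smul_eq_comp_mk₀, ProjectiveResolution.extMk_comp_mk₀]
  congr 1
  simp

end ExtMk

/-! ### Tensor products over a noncommutative ring, with k acting through the right module -/

section BalancedTensor

variable (k A W N : Type u) [Field k] [Ring A] [AddCommGroup W] [Module k W] [Module Aᵐᵒᵖ W]
  [AddCommGroup N] [Module A N]

/-- The relations `w a ⊗ n = w ⊗ a n`. -/
def balancedRelations : Submodule k (W ⊗[ℤ] N) :=
  Submodule.span k {t | ∃ (w : W) (a : A) (n : N), t = (MulOpposite.op a • w) ⊗ₜ n - w ⊗ₜ (a • n)}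

/-- The tensor product `W ⊗_A N` of a right and a left module over a noncommutative algebra. -/
abbrev BalancedTensor : Type u := (W ⊗[ℤ] N) ⧸ balancedRelations k A W N

namespace BalancedTensor

variable {W N}

/-- The class of `w ⊗ n`. -/
def tmul (w : W) (n : N) : BalancedTensor k A W N :=
  (balancedRelations k A W N).mkQ (w ⊗ₜ n)

theorem add_tmul (w w' : W) (n : N) : tmul k A (w + w') n = tmul k A w n + tmul k A w' n := by
  simp only [tmul, TensorProduct.add_tmul, map_add]

theorem smul_tmul (c : k) (w : W) (n : N) : tmul k A (c • w) n = c • tmul k A w n := by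
  simp only [tmul, ← TensorProduct.smul_tmul', map_smul]

theorem tmul_add (w : W) (n n' : N) : tmul k A w (n + n') = tmul k A w n + tmul k A w n' := by
  simp only [tmul, TensorProduct.tmul_add, map_add]

theorem op_smul_tmul (a : A) (w : W) (n : N) :
    tmul k A (MulOpposite.op a • w) n = tmul k A w (a • n) :=
  (Submodule.Quotient.eq _).2 (Submodule.subset_span ⟨w, a, n, rfl⟩)

/-- The map `n ↦ w ⊗ n`. -/
def tmulHom (w : W) : N →+ BalancedTensor k A W N :=
  AddMonoidHom.mk' (tmul k A w) (tmul_add k A w)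

theorem tmul_sum {ι : Type*} (w : W) (s : Finset ι) (f : ι → N) :
    tmul k A w (∑ i ∈ s, f i) = ∑ i ∈ s, tmul k A w (f i) :=
  map_sum (tmulHom k A w) f s

variable {k A}

@[elab_as_elim]
theorem induction_on {p : BalancedTensor k A W N → Prop} (x : BalancedTensor k A W N)
    (tmul : ∀ w n, p (tmul k A w n)) (add : ∀ x y, p x → p y → p (x + y)) : p x := by
  obtain ⟨t, rfl⟩ := Submodule.mkQ_surjective _ x
  induction t using TensorProduct.induction_on with
  | zero =>
    have h := tmul 0 0
    rwa [BalancedTensor.tmul, TensorProduct.zero_tmul] at h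
  | tmul w n => exact tmul w n
  | add s t hs ht => rw [map_add]; exact add _ _ hs ht

theorem hom_ext {V : Type*} [AddCommGroup V] [Module k V] {f g : BalancedTensor k A W N →ₗ[k] V}
    (h : ∀ w n, f (tmul k A w n) = g (tmul k A w n)) : f = g := by
  refine LinearMap.ext fun x => ?_
  induction x using induction_on with
  | tmul w n => exact h w n
  | add x y hx hy => rw [map_add, map_add, hx, hy]

/-- The linear map out of `W ⊗_A N` given by a balanced biadditive map. -/
def lift {V : Type*} [AddCommGroup V] [Module k V] (f : W →ₗ[k] N →ₗ[ℤ] V)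
    (hf : ∀ w (a : A) n, f (MulOpposite.op a • w) n = f w (a • n)) :
    BalancedTensor k A W N →ₗ[k] V :=
  (balancedRelations k A W N).liftQ (TensorProduct.AlgebraTensorModule.lift f) (by
    rw [balancedRelations, Submodule.span_le]
    rintro _ ⟨w, a, n, rfl⟩
    simp [hf])

variable {N' N'' : Type u} [AddCommGroup N'] [Module A N'] [AddCommGroup N''] [Module A N'']

variable (k W) in
/-- The map `W ⊗_A f`. -/
def map (f : N →ₗ[A] N') : BalancedTensor k A W N →ₗ[k] BalancedTensor k A W N' :=
  lift
    { toFun := fun w => ((tmulHom k A w).comp f.toAddMonoidHom).toIntLinearMap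
      map_add' := fun w w' => LinearMap.ext fun n => add_tmul k A w w' (f n)
      map_smul' := fun c w => LinearMap.ext fun n => smul_tmul k A c w (f n) }
    (fun w a n => (op_smul_tmul k A a w (f n)).trans (congrArg _ (f.map_smul a n).symm))

theorem map_tmul (f : N →ₗ[A] N') (w : W) (n : N) :
    map k W f (tmul k A w n) = tmul k A w (f n) := rfl

theorem map_id : map k W (LinearMap.id : N →ₗ[A] N) = LinearMap.id := hom_ext fun _ _ => rfl

theorem map_comp (g : N' →ₗ[A] N'') (f : N →ₗ[A] N') :
    map k W (g ∘ₗ f) = map k W g ∘ₗ map k W f := hom_ext fun _ _ => rfl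

theorem map_add (f g : N →ₗ[A] N') : map k W (f + g) = map k W f + map k W g :=
  hom_ext fun w n => tmul_add k A w (f n) (g n)

end BalancedTensor

/-- The functor `W ⊗_A -`. -/
@[simps]
def balancedTensorFunctor : ModuleCat.{u} A ⥤ ModuleCat.{u} k where
  obj N := ModuleCat.of k (BalancedTensor k A W N)
  map f := ModuleCat.ofHom (BalancedTensor.map k W f.hom)
  map_id N := by
    rw [ModuleCat.hom_id, BalancedTensor.map_id]; rfl
  map_comp f g := by
    rw [ModuleCat.hom_comp, BalancedTensor.map_comp]; rfl

instance : (balancedTensorFunctor k A W).Additive where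
  map_add {_ _ f g} := by
    ext : 1
    exact BalancedTensor.map_add f.hom g.hom

end BalancedTensor

/-! ### Duality for finitely generated projective modules -/

section Dual

variable {k A W N : Type u} [Field k] [Ring A] [Algebra k A] [AddCommGroup W] [Module k W]
  [Module Aᵐᵒᵖ W] [IsScalarTower k Aᵐᵒᵖ W] [AddCommGroup N] [Module A N]

/-- A surjection Aⁿ → N splits; the eᵢ are the images of the standard basis and the fᵢ the
coordinates of the splitting. -/
theorem exists_dual_basis (A N : Type u) [Ring A] [AddCommGroup N] [Module A N] [Module.Finite A N]
    [Module.Projective A N] :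
    ∃ (n : ℕ) (e : Fin n → N) (f : Fin n → N →ₗ[A] A), ∀ x, ∑ i, f i x • e i = x := by
  obtain ⟨n, p, hp⟩ := Module.Finite.exists_fin' A N
  obtain ⟨s, hs⟩ := Module.projective_lifting_property p LinearMap.id hp
  refine ⟨n, fun i => p (fun j => if i = j then 1 else 0), fun i => (LinearMap.proj i).comp s, fun x => ?_⟩
  conv_rhs => rw [← LinearMap.id_apply (R := A) x, ← hs, LinearMap.comp_apply,
    LinearMap.pi_apply_eq_sum_univ p (s x)]
  rfl

/-- The dual of a finitely generated projective left module is a projective right module. -/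
theorem projective_dual [Module.Finite A N] [Module.Projective A N] :
    Module.Projective Aᵐᵒᵖ (N →ₗ[A] A) := by
  obtain ⟨n, e, f, h⟩ := exists_dual_basis A N
  -- Evaluation at the eⱼ. The dual basis identity makes `p` a retraction of it, so the dual is a
  -- summand of a free module.
  let i : (N →ₗ[A] A) →ₗ[Aᵐᵒᵖ] (Fin n → Aᵐᵒᵖ) :=
    { toFun := fun g j => MulOpposite.op (g (e j))
      map_add' := fun _ _ => rfl
      map_smul' := fun _ _ => rfl }
  let p : (Fin n → Aᵐᵒᵖ) →ₗ[Aᵐᵒᵖ] (N →ₗ[A] A) := Fintype.linearCombination Aᵐᵒᵖ f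
  refine Module.Projective.of_split i p (LinearMap.ext fun g => LinearMap.ext fun x => ?_)
  conv_rhs => rw [LinearMap.id_apply, ← h x]
  simp [i, p, Fintype.linearCombination_apply, LinearMap.sum_apply]

variable (k A W N) in
/-- The map `W ⊗_A N → Hom_{Aᵒᵖ}(Hom_A(N, A), W)`. -/
def tensorEval : BalancedTensor k A W N →ₗ[k] ((N →ₗ[A] A) →ₗ[Aᵐᵒᵖ] W) :=
  BalancedTensor.lift
    { toFun := fun w => AddMonoidHom.toIntLinearMap (AddMonoidHom.mk' (fun n =>
        { toFun := fun f => MulOpposite.op (f n) • w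
          map_add' := fun f g => by simp [add_smul]
          map_smul' := fun a f => by simp [mul_smul] })
        (fun n n' => by ext f; simp [add_smul]))
      map_add' := fun w w' => by ext n f; simp
      map_smul' := fun c w => by ext n f; simp [smul_comm _ c] }
    (fun w a n => by ext f; simp [mul_smul])

theorem tensorEval_tmul (w : W) (n : N) (f : N →ₗ[A] A) :
    tensorEval k A W N (BalancedTensor.tmul k A w n) f = MulOpposite.op (f n) • w := rfl

theorem tensorEval_map {N' : Type u} [AddCommGroup N'] [Module A N'] (g : N →ₗ[A] N')
    (z : BalancedTensor k A W N) (f : N' →ₗ[A] A) :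
    tensorEval k A W N' (BalancedTensor.map k W g z) f = tensorEval k A W N z (f ∘ₗ g) := by
  induction z using BalancedTensor.induction_on with
  | tmul w n => rfl
  | add x y hx hy => simp only [_root_.map_add, LinearMap.add_apply, hx, hy]

/-- The inverse is φ ↦ ∑ φ(fᵢ) ⊗ eᵢ for a dual basis (eᵢ, fᵢ); both composites reduce to x = ∑ fᵢ(x)
eᵢ. -/
theorem tensorEval_bijective [Module.Finite A N] [Module.Projective A N] :
    Function.Bijective (tensorEval k A W N) := by
  obtain ⟨n, e, f, h⟩ := exists_dual_basis A N
  refine Function.bijective_iff_has_inverse.2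
    ⟨fun φ => ∑ i, BalancedTensor.tmul k A (φ (f i)) (e i), fun z => ?_, fun φ => ?_⟩
  · induction z using BalancedTensor.induction_on with
    | tmul w x =>
      simp only [tensorEval_tmul, BalancedTensor.op_smul_tmul, ← BalancedTensor.tmul_sum, h]
    | add x y hx hy =>
      conv_rhs => rw [← hx, ← hy]
      simp only [_root_.map_add, LinearMap.add_apply, BalancedTensor.add_tmul,
        Finset.sum_add_distrib]
  · refine LinearMap.ext fun g => ?_
    simp only [map_sum, LinearMap.sum_apply, tensorEval_tmul, ← map_smul]
    rw [← map_sum]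
    refine congrArg φ (LinearMap.ext fun x => ?_)
    conv_rhs => rw [← h x]
    simp [LinearMap.sum_apply]

end Dual

/-! ### The dual of a finite resolution of k resolves the integral -/

section DualComplex

variable {A : Type u} [Ring A]

/-- The right module `Hom_A(N, A)`. -/
abbrev dualObj (N : ModuleCat.{u} A) : ModuleCat.{u} Aᵐᵒᵖ := ModuleCat.of Aᵐᵒᵖ (N →ₗ[A] A)

/-- The map `Hom_A(g, A)`. -/
def dualMap {N N' : ModuleCat.{u} A} (g : N ⟶ N') : dualObj N' ⟶ dualObj N :=
  ModuleCat.ofHom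
    { toFun := fun f => f ∘ₗ g.hom
      map_add' := fun _ _ => rfl
      map_smul' := fun _ _ => rfl }

/-- The dual of a cochain complex, with `Hom_A(Cⁱ⁻ᵈ, A)` in degree `i`. -/
def dualComplex (C : CochainComplex (ModuleCat.{u} A) ℤ) (d : ℕ) :
    ChainComplex (ModuleCat.{u} Aᵐᵒᵖ) ℕ where
  -- A resolution P has P_n in cochain degree -n, so degree i holds the dual of P_{d-i}. The
  -- subtraction takes place in ℤ: for i > d the degree is positive and the term is zero, whereas
  -- truncated subtraction would repeat P₀.
  X i := dualObj (C.X (i - d))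
  d i j := dualMap (C.d (j - d) (i - d))
  shape i j h := by
    rw [C.shape _ _ (fun h' => h (by simp at h' ⊢; omega))]
    exact ModuleCat.hom_ext (LinearMap.ext fun f => LinearMap.comp_zero f)
  d_comp_d' i j l _ _ := by
    ext f : 2
    refine LinearMap.ext fun x => ?_
    change f ((C.d (l - d) (j - d) ≫ C.d (j - d) (i - d)) x) = 0
    rw [C.d_comp_d]
    exact f.map_zero

end DualComplex

section IntegralResolution

variable {k A : Type u} [Field k] [Ring A] [Algebra k A] (ε : A →ₐ[k] k)
  (R : ProjectiveResolution (ModuleCat.of A (TrivialModule ε))) {d : ℕ}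
  (hR : ∀ n, d < n → Limits.IsZero (R.complex.X n))

/-- The map from the dual of the last term of a resolution of `k` of length `d` to `∫^l`. -/
def toLeftIntegral : (dualComplex R.cochainComplex d).X 0 ⟶
    ModuleCat.of Aᵐᵒᵖ (LeftIntegral ε d) :=
  ModuleCat.ofHom
    { toFun := fun f => R.extMk
        ((R.cochainComplexXIso ((0 : ℕ) - d) d (by simp)).inv ≫ ModuleCat.ofHom f) (d + 1) rfl
        -- Since P_{d+1} = 0, every map P_d → A is a cocycle.
        ((hR _ d.lt_succ_self).eq_of_src _ _)
      map_add' := fun f g => by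
        refine Eq.trans ?_ (R.add_extMk _ _ _ _ _ _).symm
        congr 1
      map_smul' := fun a f => by
        refine Eq.trans ?_ (R.extMk_comp_mk₀ _ _ _ _ _).symm
        congr 1 }

theorem toLeftIntegral_surjective : Function.Surjective (toLeftIntegral ε R hR) := by
  intro e
  obtain ⟨f, hf, rfl⟩ := R.extMk_surjective (show TrivialExt ε d from e) (d + 1) rfl
  refine ⟨((R.cochainComplexXIso ((0 : ℕ) - d) d (by simp)).hom ≫ f).hom, ?_⟩
  refine congrArg (fun g => R.extMk g (d + 1) rfl
    ((hR _ d.lt_succ_self).eq_of_src _ _)) ?_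
  exact Iso.inv_hom_id_assoc _ f

theorem cochainComplex_isZero (hR : ∀ n, d < n → Limits.IsZero (R.complex.X n)) (n : ℤ) (hn : n < -d) :
    Limits.IsZero (R.cochainComplex.X n) := by
  obtain ⟨l, rfl⟩ := Int.exists_eq_neg_ofNat (show n ≤ 0 by omega)
  exact (hR l (by omega)).of_iso (R.cochainComplexXIso _ l rfl)

theorem finite_cochainComplex (hfin : ∀ n, Module.Finite A (R.complex.X n)) (n : ℤ) :
    Module.Finite A (R.cochainComplex.X n) := by
  by_cases hn : n ≤ 0
  · obtain ⟨l, rfl⟩ := Int.exists_eq_neg_ofNat hn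
    have := hfin l
    exact Module.Finite.equiv (R.cochainComplexXIso _ l rfl).symm.toLinearEquiv
  · have := ModuleCat.subsingleton_of_isZero
      (CochainComplex.isZero_of_isStrictlyLE R.cochainComplex 0 n (by omega))
    infer_instance

/-- If `Ext^i_A(k, A) = 0` for `i ≠ d`, then the dual of a resolution of `k` of length `d` by
finitely generated projective modules is a resolution of `∫^l`. -/
def integralResolution (hfin : ∀ n, Module.Finite A (R.complex.X n))
    (hε : ∀ i, i ≠ d → Subsingleton (TrivialExt ε i)) :
    ProjectiveResolution (ModuleCat.of Aᵐᵒᵖ (LeftIntegral ε d)) :=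
  resolutionOfExact (dualComplex R.cochainComplex d) (toLeftIntegral ε R hR)
    (fun i => by
      have := finite_cochainComplex ε R hfin (i - d)
      have : Module.Projective A (R.cochainComplex.X (i - d)) :=
        ModuleCat.projective_of_module_projective _
      exact (IsProjective.iff_projective _).1 projective_dual)
    (toLeftIntegral_surjective ε R hR)
    (by
      ext f : 2
      -- Degree -d - 1 lies beyond the end of the resolution, so the cocycle condition is empty; a
      -- map in the image of the dual differential is a coboundary and has class 0. The converse
      -- implication below gives exactness in degree 0.
      refine (extMk_cochain_eq_zero_iff R d _ (-d - 1) ((1 : ℕ) - d) _ (by simp) (by push_cast; ring)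
        (ModuleCat.ofHom ((dualComplex R.cochainComplex d).d 1 0 f))
        ((cochainComplex_isZero ε R hR _ (by omega)).eq_of_src _ _)
        ((hR _ d.lt_succ_self).eq_of_src _ _)).2 ⟨ModuleCat.ofHom f, rfl⟩)
    (fun f hf => by
      obtain ⟨g, hg⟩ := (extMk_cochain_eq_zero_iff R d _ (-d - 1) ((1 : ℕ) - d) _ (by simp)
        (by push_cast; ring) _ ((cochainComplex_isZero ε R hR _ (by omega)).eq_of_src _ _)
        ((hR _ d.lt_succ_self).eq_of_src _ _)).1 hf
      exact ⟨g.hom, congrArg ModuleCat.Hom.hom hg⟩)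
    (fun i f hf => by
      by_cases hi : i + 1 ≤ d
      -- Exactness in degree i + 1 is the vanishing of Ext in degree n = d - (i + 1), which differs
      -- from d.
      · obtain ⟨n, hn⟩ := Nat.exists_eq_add_of_le hi
        have hs := hε n (by omega)
        have hf' : R.cochainComplex.d (i - d) ((i + 1 : ℕ) - d) ≫ ModuleCat.ofHom f = 0 :=
          ModuleCat.hom_ext hf
        obtain ⟨g, hg⟩ := exists_comp_eq_of_subsingleton_ext R hs ((i + 1 : ℕ) - d) (i - d)
          ((i + 2 : ℕ) - d) (by omega) (by omega) (by omega) (ModuleCat.ofHom f) hf'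
        exact ⟨g.hom, congrArg ModuleCat.Hom.hom hg⟩
      -- Beyond degree d the term is the dual of a zero module.
      · refine ⟨0, ?_⟩
        have h0 : ModuleCat.ofHom f = 0 := (CochainComplex.isZero_of_isStrictlyLE R.cochainComplex
          0 ((i + 1 : ℕ) - d) (by omega)).eq_of_src _ _
        exact (map_zero _).trans (congrArg ModuleCat.Hom.hom h0).symm)

end IntegralResolution

/-! ### Cycles and boundaries under the change from ℕ to ℤ indexing -/

section MappedResolution

variable {k A : Type u} [Field k] [Ring A] (F : ModuleCat.{u} A ⥤ ModuleCat.{u} k)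
  {X : ModuleCat.{u} A} (R : ProjectiveResolution X)

theorem map_cochainComplex_d_eq_zero_iff [F.Additive] (n : ℕ) (m m' : ℤ) (hn : -(n : ℤ) = m) (hm : m + 1 = m')
    (z : F.obj (R.complex.X n)) :
    F.map (R.cochainComplex.d m m') (F.map (R.cochainComplexXIso m n hn).inv z) = 0 ↔
      F.map (R.complex.d n ((ComplexShape.down ℕ).next n)) z = 0 := by
  rcases n with _ | n
  · have h0 : R.cochainComplex.d m m' = 0 :=
      (CochainComplex.isZero_of_isStrictlyLE R.cochainComplex 0 m' (by omega)).eq_of_tgt _ _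
    -- Here `next 0` is 0 by default, and the resulting `d 0 0` is zero because it is not an arrow
    -- of the shape; in the cochain complex the target itself is zero.
    have h1 : R.complex.d 0 ((ComplexShape.down ℕ).next 0) = 0 :=
      R.complex.shape _ _ (by simp)
    rw [h0, h1, F.map_zero, F.map_zero]
    exact iff_of_true rfl rfl
  · rw [ChainComplex.next_nat_succ, R.cochainComplex_d m m' (n + 1) n hn (by omega),
      ← ModuleCat.comp_apply, ← F.map_comp, Iso.inv_hom_id_assoc, F.map_comp, ModuleCat.comp_apply]
    exact map_eq_zero_iff _ ((ModuleCat.mono_iff_injective _).1 inferInstance)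

theorem exists_map_cochainComplex_d_iff (n : ℕ) (m m' : ℤ) (hn : -(n : ℤ) = m) (hm : m' + 1 = m)
    (z : F.obj (R.complex.X n)) :
    (∃ y, F.map (R.cochainComplex.d m' m) y = F.map (R.cochainComplexXIso m n hn).inv z) ↔
      ∃ y, F.map (R.complex.d (n + 1) n) y = z := by
  have hinj : Function.Injective (F.map (R.cochainComplexXIso m n hn).inv) :=
    (ModuleCat.mono_iff_injective _).1 inferInstance
  have hn' : -((n + 1 : ℕ) : ℤ) = m' := by omega
  rw [R.cochainComplex_d m' m (n + 1) n hn' hn]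
  constructor
  · rintro ⟨y, hy⟩
    refine ⟨F.map (R.cochainComplexXIso m' (n + 1) hn').hom y, hinj ?_⟩
    rw [← hy]
    simp only [F.map_comp, ModuleCat.comp_apply]
  · rintro ⟨y, rfl⟩
    refine ⟨F.map (R.cochainComplexXIso m' (n + 1) hn').inv y, ?_⟩
    simp only [← ModuleCat.comp_apply, ← F.map_comp, Iso.inv_hom_id_assoc]

end MappedResolution

/-- If φ matches cycles with cocycles and boundaries with coboundaries, then sending a cycle to the
class of its cocycle induces the isomorphism. Degree 0 has a hypothesis of its own because no term
of Q precedes it. -/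
theorem nonempty_homology_iso_of_extMk {k : Type u} [Field k] {C : Type*} [Category C] [Abelian C]
    [Linear k C] [HasExt.{u} C] {X Y : C} (Q : ProjectiveResolution X) (i : ℕ)
    (S : ShortComplex (ModuleCat.{u} k)) (φ : S.X₂ →ₗ[k] (Q.complex.X i ⟶ Y))
    (hsurj : Function.Surjective φ) (hφ : ∀ z, Q.complex.d (i + 1) i ≫ φ z = 0 ↔ S.g z = 0)
    (h0 : i = 0 → ∀ z, φ z = 0 ↔ ∃ y, S.f y = z)
    (hs : ∀ j, j + 1 = i → ∀ z, (∃ ψ, Q.complex.d i j ≫ ψ = φ z) ↔ ∃ y, S.f y = z) :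
    Nonempty (S.homology ≅ ModuleCat.of k (Ext X Y i)) := by
  have hker : ∀ z hz, Q.extMk (φ z) (i + 1) rfl hz = 0 ↔ ∃ y, S.f y = z := by
    intro z hz
    rcases i with _ | i
    · exact (extMk_zero_eq_zero_iff Q (φ z) hz).trans (h0 rfl z)
    · exact (Q.extMk_eq_zero_iff (φ z) _ rfl hz i rfl).trans (hs i rfl z)
  let θ : LinearMap.ker S.g.hom →ₗ[k] Ext X Y i :=
    { toFun := fun z => Q.extMk (φ z.1) (i + 1) rfl ((hφ z.1).2 z.2)
      map_add' := fun z z' => by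
        rw [Q.add_extMk]
        congr 1
        exact map_add φ z.1 z'.1
      map_smul' := fun c z => by
        rw [RingHom.id_apply, smul_extMk]
        congr 1
        exact map_smul φ c z.1 }
  refine nonempty_homology_iso S θ (fun x => ?_) (fun z => hker z.1 ((hφ z.1).2 z.2))
  obtain ⟨f, hf, rfl⟩ := Q.extMk_surjective x (i + 1) rfl
  obtain ⟨z, rfl⟩ := hsurj f
  exact ⟨⟨z, (hφ z).1 hf⟩, rfl⟩

/-! ### Homology of W ⊗_A P as Ext out of the integral -/

section TorExt

variable {k A : Type u} [Field k] [Ring A] [Algebra k A] (ε : A →ₐ[k] k)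
  (R : ProjectiveResolution (ModuleCat.of A (TrivialModule ε))) {d : ℕ}
  (W : Type u) [AddCommGroup W] [Module k W] [Module Aᵐᵒᵖ W] [IsScalarTower k Aᵐᵒᵖ W]

/-- The `k`-vector space of morphisms between two modules over a `k`-algebra. -/
def homSpace (k : Type u) {B : Type u} [Field k] [Ring B] [Algebra k B] (X Y : ModuleCat.{u} B) :
    ModuleCat.{u} k := ModuleCat.of k (X ⟶ Y)

theorem homSpace_smul_apply {k B : Type u} [Field k] [Ring B] [Algebra k B] {X Y : ModuleCat.{u} B}
    (c : k) (f : homSpace k X Y) (x : X) :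
    (show X ⟶ Y from c • f).hom x = algebraMap k B c • (show X ⟶ Y from f).hom x := rfl

/-- The map `W ⊗_A P → Hom_{Aᵒᵖ}(Hom_A(P, A), W)`, as a morphism of modules. -/
def evalHom (P : ModuleCat.{u} A) :
    (balancedTensorFunctor k A W).obj P →ₗ[k]
      homSpace k (dualObj P) (ModuleCat.of Aᵐᵒᵖ W) where
  toFun z := ModuleCat.ofHom (tensorEval k A W P z)
  map_add' z z' := ModuleCat.hom_ext (map_add (tensorEval k A W P) z z')
  map_smul' c z := ModuleCat.hom_ext (LinearMap.ext fun f => by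
    refine Eq.trans ?_ (homSpace_smul_apply c _ f).symm
    -- The Hom space gets its scalars through `Aᵐᵒᵖ`; the scalar tower identifies them with the
    -- given ones on W.
    refine Eq.trans ?_ (algebraMap_smul Aᵐᵒᵖ c (tensorEval k A W P z f)).symm
    exact LinearMap.congr_fun (map_smul (tensorEval k A W P) c z) f)

theorem evalHom_map {P P' : ModuleCat.{u} A} (g : P ⟶ P')
    (z : (balancedTensorFunctor k A W).obj P) :
    evalHom W P' ((balancedTensorFunctor k A W).map g z) = dualMap g ≫ evalHom W P z := by
  exact ModuleCat.hom_ext (LinearMap.ext fun f => tensorEval_map g.hom z f)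

theorem evalHom_bijective (P : ModuleCat.{u} A) [Module.Finite A P] [Projective P] :
    Function.Bijective (evalHom (k := k) W P) := by
  have : Module.Projective A P := ModuleCat.projective_of_module_projective _
  obtain ⟨h1, h2⟩ := tensorEval_bijective (k := k) (A := A) (W := W) (N := P)
  exact ⟨fun x y h => h1 (congrArg ModuleCat.Hom.hom h),
    fun φ => (h2 φ.hom).imp fun z hz => ModuleCat.hom_ext hz⟩

theorem evalHom_eq_zero_iff (P : ModuleCat.{u} A) [Module.Finite A P] [Projective P]
    (z : (balancedTensorFunctor k A W).obj P) :
    evalHom W P z = (0 : dualObj P ⟶ ModuleCat.of Aᵐᵒᵖ W) ↔ z = 0 :=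
  map_eq_zero_iff (evalHom W P) (evalHom_bijective W P).1

/-- Naturality and injectivity of evaluation: cocycles in Hom(P*, W) are cycles in W ⊗_A P. The next
lemma is the analogue for boundaries, where surjectivity supplies the preimage of ψ. -/
theorem dualComplex_d_comp_evalHom_eq_zero_iff (C : CochainComplex (ModuleCat.{u} A) ℤ)
    (d i j : ℕ) [Module.Finite A (C.X (i - d))] [Projective (C.X (i - d))]
    (z : (balancedTensorFunctor k A W).obj (C.X (j - d))) :
    (dualComplex C d).d i j ≫ evalHom W (C.X (j - d)) z = 0 ↔
      (balancedTensorFunctor k A W).map (C.d (j - d) (i - d)) z = 0 := by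
  rw [← evalHom_eq_zero_iff W, evalHom_map]
  rfl

theorem exists_dualComplex_d_comp_iff (C : CochainComplex (ModuleCat.{u} A) ℤ)
    (d i j : ℕ) [Module.Finite A (C.X (i - d))] [Projective (C.X (i - d))]
    [Module.Finite A (C.X (j - d))] [Projective (C.X (j - d))]
    (z : (balancedTensorFunctor k A W).obj (C.X (i - d))) :
    (∃ ψ, (dualComplex C d).d i j ≫ ψ = evalHom W (C.X (i - d)) z) ↔
      ∃ y, (balancedTensorFunctor k A W).map (C.d (j - d) (i - d)) y = z := by
  constructor
  · rintro ⟨ψ, hψ⟩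
    obtain ⟨y, rfl⟩ := (evalHom_bijective (k := k) W (C.X (j - d))).2 ψ
    refine ⟨y, (evalHom_bijective W _).1 ?_⟩
    rw [evalHom_map]
    exact hψ
  · rintro ⟨y, rfl⟩
    exact ⟨evalHom W _ y, (evalHom_map W _ y).symm⟩

/-- If `P` is a resolution of `k` of length `d` by finitely generated projective modules and
`Ext^i_A(k, A) = 0` for `i ≠ d`, then `H_n(W ⊗_A P) ≅ Ext^{d - n}(∫^l, W)`. -/
theorem nonempty_homology_iso_ext (hR : ∀ n, d < n → Limits.IsZero (R.complex.X n))
    (hfin : ∀ n, Module.Finite A (R.complex.X n))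
    (hε : ∀ i, i ≠ d → Subsingleton (TrivialExt ε i)) (n i : ℕ) (hni : n + i = d) :
    Nonempty ((((balancedTensorFunctor k A W).mapHomologicalComplex _).obj R.complex).homology n ≅
      ModuleCat.of k (Ext (ModuleCat.of Aᵐᵒᵖ (LeftIntegral ε d)) (ModuleCat.of Aᵐᵒᵖ W) i)) := by
  let F := balancedTensorFunctor k A W
  let Q := integralResolution ε R hR hfin hε
  have hm : -(n : ℤ) = i - d := by omega
  have hF : ∀ m : ℤ, Module.Finite A (R.cochainComplex.X m) := finite_cochainComplex ε R hfin
  let K := (F.mapHomologicalComplex _).obj R.complex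
  let S := K.sc' (n + 1) n ((ComplexShape.down ℕ).next n)
  let φ : F.obj (R.complex.X n) →ₗ[k] homSpace k (Q.complex.X i) (ModuleCat.of Aᵐᵒᵖ W) :=
    evalHom W (R.cochainComplex.X (i - d)) ∘ₗ (F.map (R.cochainComplexXIso (i - d) n hm).inv).hom
  have hφ : ∀ z, Q.complex.d (i + 1) i ≫ φ z = 0 ↔ S.g z = 0 := fun z =>
    (dualComplex_d_comp_evalHom_eq_zero_iff W R.cochainComplex d (i + 1) i _).trans
      (map_cochainComplex_d_eq_zero_iff F R n (i - d) ((i + 1 : ℕ) - d) hm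
        (by push_cast; ring) z)
  have hsurj : Function.Surjective φ := fun x => by
    obtain ⟨z, hz⟩ := (evalHom_bijective (k := k) W (R.cochainComplex.X (i - d))).2 x
    obtain ⟨y, rfl⟩ := (ModuleCat.epi_iff_surjective
      (F.map (R.cochainComplexXIso (i - d) n hm).inv)).1 inferInstance z
    exact ⟨y, hz⟩
  -- For i = 0 one has n = d, and P_{d+1} = 0 leaves no nonzero boundaries.
  have h0 : i = 0 → ∀ z, φ z = (0 : Q.complex.X i ⟶ ModuleCat.of Aᵐᵒᵖ W) ↔ ∃ y, S.f y = z := by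
    rintro rfl z
    have h := exists_map_cochainComplex_d_iff F R n _ (-1 - d) hm (by push_cast; ring) z
    refine Iff.trans ?_ h
    have h0 : R.cochainComplex.d (-1 - d) ((0 : ℕ) - d) = 0 :=
      (cochainComplex_isZero ε R hR _ (by omega)).eq_of_src _ _
    rw [h0, F.map_zero]
    have h1 := evalHom_eq_zero_iff W (R.cochainComplex.X ((0 : ℕ) - d))
      (F.map (R.cochainComplexXIso ((0 : ℕ) - d) n hm).inv z)
    exact Iff.trans h1 ⟨fun h => ⟨0, h.symm⟩, fun ⟨y, h⟩ => h.symm⟩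
  have hs : ∀ j, j + 1 = i → ∀ z, (∃ ψ : Q.complex.X j ⟶ ModuleCat.of Aᵐᵒᵖ W,
      Q.complex.d i j ≫ ψ = φ z) ↔ ∃ y, S.f y = z := by
    rintro j rfl z
    have h := exists_map_cochainComplex_d_iff F R n _ (j - d) hm (by push_cast; ring) z
    refine Iff.trans ?_ h
    exact exists_dualComplex_d_comp_iff W R.cochainComplex d (j + 1) j
      (F.map (R.cochainComplexXIso ((j + 1 : ℕ) - d) n hm).inv z)
  obtain ⟨e⟩ := nonempty_homology_iso_of_extMk Q i S φ hsurj hφ h0 hs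
  exact ⟨ShortComplex.homologyMapIso (K.isoSc' (n + 1) n _ (by simp) rfl) ≪≫ e⟩

end TorExt

/-! ### Functoriality of Hochschild chains; right modules with trivial left action -/

section Functoriality

variable {k A M N : Type u} [Field k] [Ring A] [Algebra k A] [AddCommGroup M] [Module k M]

/-- Linear maps out of the Hochschild chains agree if they agree on pure tensors. -/
theorem chain_hom_ext {n : ℕ} {V : Type*} [AddCommGroup V] [Module k V]
    {f g : HochschildChain k A M n →ₗ[k] V}
    (h : ∀ m a, f (m ⊗ₜ PiTensorProduct.tprod k a) = g (m ⊗ₜ PiTensorProduct.tprod k a)) :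
    f = g := by
  refine TensorProduct.ext (LinearMap.ext fun m => PiTensorProduct.ext (MultilinearMap.ext ?_))
  exact fun a => h m a

variable [Module A M] [Module Aᵐᵒᵖ M] [IsScalarTower k A M]
  [IsScalarTower k Aᵐᵒᵖ M]
  [AddCommGroup N] [Module k N] [Module A N] [Module Aᵐᵒᵖ N] [IsScalarTower k A N]
  [IsScalarTower k Aᵐᵒᵖ N]

/-- A map of bimodules commutes with the faces. -/
theorem face_rTensor (g : M →ₗ[k] N) (hl : ∀ (a : A) m, g (a • m) = a • g m)
    (hr : ∀ (a : Aᵐᵒᵖ) m, g (a • m) = a • g m) {n : ℕ} (i : Fin (n + 2))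
    (x : HochschildChain k A M (n + 1)) :
    face k A N i (g.rTensor _ x) = g.rTensor _ (face k A M i x) := by
  refine LinearMap.congr_fun (f := face k A N i ∘ₗ g.rTensor _)
    (g := g.rTensor _ ∘ₗ face k A M i) (chain_hom_ext fun m a => ?_) x
  simp only [LinearMap.comp_apply, LinearMap.rTensor_tmul, face_tmul_tprod]
  congr 1
  simp only [faceHead]
  split_ifs <;> simp [hl, hr]

theorem hochschildD_apply [SMulCommClass A Aᵐᵒᵖ M] (n : ℕ) (x : HochschildChain k A M (n + 1)) :
    hochschildD k A M n x = ∑ i : Fin (n + 2), (-1 : ℤ) ^ (i : ℕ) • face k A M i x := by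
  simp [hochschildD, LinearMap.sum_apply]

/-- Used for two bimodule maps: left multiplication on A, which makes the bar differential A-linear,
and a ↦ wa, which compares W ⊗_A B with Hochschild chains. -/
theorem hochschildD_rTensor [SMulCommClass A Aᵐᵒᵖ M] [SMulCommClass A Aᵐᵒᵖ N]
    (g : M →ₗ[k] N) (hl : ∀ (a : A) m, g (a • m) = a • g m)
    (hr : ∀ (a : Aᵐᵒᵖ) m, g (a • m) = a • g m) (n : ℕ)
    (x : HochschildChain k A M (n + 1)) :
    hochschildD k A N n (g.rTensor _ x) = g.rTensor _ (hochschildD k A M n x) := by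
  simp only [hochschildD_apply, map_sum, map_zsmul, face_rTensor g hl hr]

end Functoriality

section TrivialLeft

variable {k A : Type u} [Field k] [Ring A] [Algebra k A]

/-- The bimodule given by a right module `W`, with `A` acting from the left through `ε`. -/
@[nolint unusedArguments]
def TrivialLeft (_ε : A →ₐ[k] k) (W : Type u) : Type u := W

variable (ε : A →ₐ[k] k) (W : Type u) [AddCommGroup W] [Module k W]

instance : AddCommGroup (TrivialLeft ε W) := inferInstanceAs (AddCommGroup W)
instance : Module k (TrivialLeft ε W) := inferInstanceAs (Module k W)
instance : Module A (TrivialLeft ε W) := Module.compHom W ε.toRingHom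

theorem trivialLeft_smul (a : A) (w : TrivialLeft ε W) : a • w = ε a • w := rfl

/-- The identity map from `W` to the bimodule `TrivialLeft ε W`. -/
def toTrivialLeft : W ≃ₗ[k] TrivialLeft ε W := LinearEquiv.refl k W

instance : IsScalarTower k A (TrivialLeft ε W) where
  smul_assoc c a w := by
    rw [trivialLeft_smul, trivialLeft_smul, map_smul, smul_assoc]

variable [Module Aᵐᵒᵖ W]

instance : Module Aᵐᵒᵖ (TrivialLeft ε W) := inferInstanceAs (Module Aᵐᵒᵖ W)

theorem op_smul_toTrivialLeft (b : Aᵐᵒᵖ) (w : W) :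
    b • toTrivialLeft ε W w = toTrivialLeft ε W (b • w) := rfl

variable [IsScalarTower k Aᵐᵒᵖ W]

instance : IsScalarTower k Aᵐᵒᵖ (TrivialLeft ε W) := inferInstanceAs (IsScalarTower k Aᵐᵒᵖ W)

instance : SMulCommClass A Aᵐᵒᵖ (TrivialLeft ε W) where
  smul_comm a b w := by
    rw [trivialLeft_smul, trivialLeft_smul, smul_comm]

end TrivialLeft

/-! ### The bar resolution of the trivial module -/

section Bar

variable {k A : Type u} [Field k] [Ring A] [Algebra k A] (ε : A →ₐ[k] k)

/-- The term `A ⊗ A ⊗ ⋯ ⊗ A` of the bar resolution, as a left module. -/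
def BarModule (n : ℕ) : Type u := HochschildChain k A (TrivialLeft ε A) n

instance (n : ℕ) : AddCommGroup (BarModule ε n) :=
  inferInstanceAs (AddCommGroup (HochschildChain k A (TrivialLeft ε A) n))

/-- A acts by left multiplication on the first factor. The coefficients `TrivialLeft ε A` already
carry a different left action, through ε, which enters the last face; the separate type keeps the
two apart. -/
instance (n : ℕ) : Module A (BarModule ε n) :=
  inferInstanceAs (Module A (A ⊗[k] PiTensorProduct k (fun _ : Fin n => A)))

/-- The identity map from the Hochschild chains to the bar module. -/
def toBar (n : ℕ) : HochschildChain k A (TrivialLeft ε A) n ≃+ BarModule ε n := AddEquiv.refl _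

/-- Left multiplication, as a map of bimodules. -/
def leftMul (a : A) : TrivialLeft ε A →ₗ[k] TrivialLeft ε A :=
  (toTrivialLeft ε A).toLinearMap ∘ₗ LinearMap.mulLeft k a ∘ₗ (toTrivialLeft ε A).symm.toLinearMap

theorem leftMul_apply (a b : A) :
    leftMul ε a (toTrivialLeft ε A b) = toTrivialLeft ε A (a * b) := rfl

theorem leftMul_op_smul (a : A) (b : Aᵐᵒᵖ) (m : TrivialLeft ε A) :
    leftMul ε a (b • m) = b • leftMul ε a m := by
  obtain ⟨m, rfl⟩ := (toTrivialLeft ε A).surjective m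
  rw [op_smul_toTrivialLeft, leftMul_apply, leftMul_apply, op_smul_toTrivialLeft, mul_smul_comm]

theorem smul_toBar (n : ℕ) (a : A) (x : HochschildChain k A (TrivialLeft ε A) n) :
    a • toBar ε n x = toBar ε n ((leftMul ε a).rTensor _ x) := rfl

instance (n : ℕ) : Module.Free A (BarModule ε n) :=
  inferInstanceAs (Module.Free A (A ⊗[k] PiTensorProduct k (fun _ : Fin n => A)))

/-- The differential of the bar resolution. -/
def barD (n : ℕ) : BarModule ε (n + 1) →ₗ[A] BarModule ε n where
  toFun x := toBar ε n (hochschildD k A (TrivialLeft ε A) n ((toBar ε (n + 1)).symm x))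
  map_add' x y := by simp only [map_add]
  map_smul' a x := by
    obtain ⟨x, rfl⟩ := (toBar ε (n + 1)).surjective x
    rw [smul_toBar, AddEquiv.symm_apply_apply, AddEquiv.symm_apply_apply, RingHom.id_apply,
      smul_toBar, hochschildD_rTensor (leftMul ε a) (fun b m => ?_) (leftMul_op_smul ε a)]
    rw [trivialLeft_smul, map_smul, trivialLeft_smul]

theorem barD_toBar (n : ℕ) (x : HochschildChain k A (TrivialLeft ε A) (n + 1)) :
    barD ε n (toBar ε (n + 1) x) = toBar ε n (hochschildD k A (TrivialLeft ε A) n x) := rfl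

theorem barD_barD (n : ℕ) (x : BarModule ε (n + 2)) : barD ε n (barD ε (n + 1) x) = 0 := by
  obtain ⟨x, rfl⟩ := (toBar ε (n + 2)).surjective x
  rw [barD_toBar, barD_toBar, ← LinearMap.comp_apply, hochschildD_comp, LinearMap.zero_apply,
    map_zero]

/-- The bar complex of left modules, with terms `A ⊗ A ⊗ ⋯ ⊗ A`. -/
def barComplex : ChainComplex (ModuleCat.{u} A) ℕ :=
  ChainComplex.of (fun n => ModuleCat.of A (BarModule ε n)) (fun n => ModuleCat.ofHom (barD ε n))
    (fun n => ModuleCat.hom_ext (LinearMap.ext (barD_barD ε n)))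

theorem barComplex_d (n : ℕ) : (barComplex ε).d (n + 1) n = ModuleCat.ofHom (barD ε n) :=
  ChainComplex.of_d (fun n => ModuleCat.of A (BarModule ε n)) (fun n => ModuleCat.ofHom (barD ε n)) _

variable (k A) in
/-- The map `a ⊗ (a₁ ⊗ ⋯ ⊗ aₙ) ↦ a ⊗ a₁ ⊗ ⋯ ⊗ aₙ`. -/
def consHom (n : ℕ) : A ⊗[k] PiTensorProduct k (fun _ : Fin n => A) →ₗ[k]
    PiTensorProduct k (fun _ : Fin (n + 1) => A) :=
  TensorProduct.lift (PiTensorProduct.lift.toLinearMap ∘ₗ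
    (PiTensorProduct.tprod k (s := fun _ : Fin (n + 1) => A)).curryLeft)

theorem consHom_tmul (n : ℕ) (a : A) (v : Fin n → A) :
    consHom k A n (a ⊗ₜ PiTensorProduct.tprod k v) =
      PiTensorProduct.tprod k (Fin.cons a v : Fin (n + 1) → A) := by
  simp [consHom]

/-- The contracting homotopy of the bar complex. -/
def barHomotopy (n : ℕ) : HochschildChain k A (TrivialLeft ε A) n →ₗ[k]
    HochschildChain k A (TrivialLeft ε A) (n + 1) :=
  TensorProduct.mk k (TrivialLeft ε A) _ (toTrivialLeft ε A 1) ∘ₗ consHom k A n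

theorem barHomotopy_tmul (n : ℕ) (a : A) (v : Fin n → A) :
    barHomotopy ε n (toTrivialLeft ε A a ⊗ₜ PiTensorProduct.tprod k v) =
      toTrivialLeft ε A 1 ⊗ₜ PiTensorProduct.tprod k (Fin.cons a v : Fin (n + 1) → A) :=
  congrArg (fun t => toTrivialLeft ε A 1 ⊗ₜ[k] t) (consHom_tmul (k := k) n a v)

theorem face_zero_barHomotopy (n : ℕ) (x : HochschildChain k A (TrivialLeft ε A) n) :
    face k A (TrivialLeft ε A) 0 (barHomotopy ε n x) = x := by
  refine LinearMap.congr_fun (f := face k A (TrivialLeft ε A) 0 ∘ₗ barHomotopy ε n)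
    (g := LinearMap.id) (chain_hom_ext fun m a => ?_) x
  obtain ⟨m, rfl⟩ := (toTrivialLeft ε A).surjective m
  rw [LinearMap.comp_apply, barHomotopy_tmul, face_tmul_tprod]
  congr 1
  simp [faceHead, op_smul_toTrivialLeft]

/-- Moving the coefficient m into the tensor turns face i into face i + 1. The entry c records the
one interaction: for i = 0 the product m a₀, formerly in the coefficient slot, becomes the first
tensor entry. -/
theorem faceTail_succ_cons {n : ℕ} (i : Fin (n + 2)) (m c : A) (a : Fin (n + 1) → A)
    (h0 : (i : ℕ) = 0 → c = m * a 0) (h1 : (i : ℕ) ≠ 0 → c = m) :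
    faceTail i.succ (Fin.cons m a : Fin (n + 2) → A) = Fin.cons c (faceTail i a) := by
  funext j
  refine Fin.cases ?_ (fun j => ?_) j
  · by_cases hi : (i : ℕ) = 0
    · simp [faceTail, hi, h0 hi]
    · have h2 : 0 < (i : ℕ) := by omega
      have h3 : (0 : Fin (n + 1)).castSucc = 0 := rfl
      simp [faceTail, h2, h1 hi, h3]
  · simp only [faceTail, Fin.val_succ, Fin.cons_succ, ← Fin.succ_castSucc, Nat.add_lt_add_iff_right,
      Nat.add_right_cancel_iff]

theorem face_succ_barHomotopy (n : ℕ) (i : Fin (n + 2))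
    (x : HochschildChain k A (TrivialLeft ε A) (n + 1)) :
    face k A (TrivialLeft ε A) i.succ (barHomotopy ε (n + 1) x) =
      barHomotopy ε n (face k A (TrivialLeft ε A) i x) := by
  refine LinearMap.congr_fun (f := face k A (TrivialLeft ε A) i.succ ∘ₗ barHomotopy ε (n + 1))
    (g := barHomotopy ε n ∘ₗ face k A (TrivialLeft ε A) i) (chain_hom_ext fun m a => ?_) x
  obtain ⟨m, rfl⟩ := (toTrivialLeft ε A).surjective m
  rw [LinearMap.comp_apply, LinearMap.comp_apply, barHomotopy_tmul, face_tmul_tprod,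
    face_tmul_tprod]
  by_cases hi : (i : ℕ) = n + 1
  · have e1 : faceHead i (toTrivialLeft ε A m) a = ε (a (Fin.last n)) • toTrivialLeft ε A m := by
      simp [faceHead, hi, trivialLeft_smul]
    have e2 : faceHead i.succ (toTrivialLeft ε A 1) (Fin.cons m a : Fin (n + 2) → A) =
        ε (a (Fin.last n)) • toTrivialLeft ε A 1 := by
      simp only [faceHead, Fin.val_succ, hi, ← Fin.succ_last, Fin.cons_succ, trivialLeft_smul,
        Nat.succ_ne_zero, if_false, if_true]
    rw [e1, e2, ← TensorProduct.smul_tmul', ← TensorProduct.smul_tmul', map_smul,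
      barHomotopy_tmul, faceTail_succ_cons i m m a (by omega) (fun _ => rfl)]
  · have e2 : faceHead i.succ (toTrivialLeft ε A 1) (Fin.cons m a : Fin (n + 2) → A) =
        toTrivialLeft ε A 1 := by
      simp [faceHead, hi]
    obtain ⟨c, e1, h0, h1⟩ : ∃ c, faceHead i (toTrivialLeft ε A m) a = toTrivialLeft ε A c ∧
        ((i : ℕ) = 0 → c = m * a 0) ∧ ((i : ℕ) ≠ 0 → c = m) := by
      by_cases h : (i : ℕ) = 0
      · exact ⟨m * a 0, by simp only [faceHead, h, if_true]; rfl, fun _ => rfl,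
          fun h' => absurd h h'⟩
      · exact ⟨m, by simp only [faceHead, h, hi, if_false], fun h' => absurd h' h, fun _ => rfl⟩
    rw [e1, e2, barHomotopy_tmul, faceTail_succ_cons i m c a h0 h1]

/-- With h the homotopy, d₀h = id and dᵢ₊₁h = hdᵢ; the alternating sum gives ∂h = id - h∂. The map h
is only k-linear, which is enough for exactness. -/
theorem hochschildD_barHomotopy (n : ℕ) (x : HochschildChain k A (TrivialLeft ε A) (n + 1)) :
    hochschildD k A (TrivialLeft ε A) (n + 1) (barHomotopy ε (n + 1) x) =
      x - barHomotopy ε n (hochschildD k A (TrivialLeft ε A) n x) := by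
  rw [hochschildD_apply, Fin.sum_univ_succ, face_zero_barHomotopy, hochschildD_apply, map_sum,
    sub_eq_add_neg, ← Finset.sum_neg_distrib]
  congr 1
  · simp
  · refine Finset.sum_congr rfl fun i _ => ?_
    rw [face_succ_barHomotopy, map_zsmul, Fin.val_succ, pow_succ, mul_neg_one, neg_smul]

variable (k A) in
/-- The map `a ⊗ 1 ↦ ε(a)` on Hochschild chains of degree zero. -/
def chainAugmentation : HochschildChain k A (TrivialLeft ε A) 0 →ₗ[k] k :=
  LinearMap.mul' k k ∘ₗ TensorProduct.map
    (ε.toLinearMap ∘ₗ (toTrivialLeft ε A).symm.toLinearMap)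
    (PiTensorProduct.isEmptyEquiv (Fin 0)).toLinearMap

theorem chainAugmentation_tmul (a : A) (t : PiTensorProduct k (fun _ : Fin 0 => A)) :
    chainAugmentation k A ε (toTrivialLeft ε A a ⊗ₜ t) =
      ε a * PiTensorProduct.isEmptyEquiv (Fin 0) t := rfl

theorem chainAugmentation_tprod (a : A) (v : Fin 0 → A) :
    chainAugmentation k A ε (toTrivialLeft ε A a ⊗ₜ PiTensorProduct.tprod k v) = ε a := by
  rw [chainAugmentation_tmul, PiTensorProduct.isEmptyEquiv_apply_tprod, mul_one]

theorem chainAugmentation_leftMul (a : A) (x : HochschildChain k A (TrivialLeft ε A) 0) :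
    chainAugmentation k A ε ((leftMul ε a).rTensor _ x) = ε a * chainAugmentation k A ε x := by
  refine LinearMap.congr_fun (f := chainAugmentation k A ε ∘ₗ (leftMul ε a).rTensor _)
    (g := LinearMap.mulLeft k (ε a) ∘ₗ chainAugmentation k A ε) (chain_hom_ext fun m v => ?_) x
  obtain ⟨m, rfl⟩ := (toTrivialLeft ε A).surjective m
  rw [LinearMap.comp_apply, LinearMap.comp_apply, LinearMap.rTensor_tmul, leftMul_apply,
    chainAugmentation_tprod, chainAugmentation_tprod, map_mul, LinearMap.mulLeft_apply]

theorem chainAugmentation_hochschildD (x : HochschildChain k A (TrivialLeft ε A) 1) :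
    chainAugmentation k A ε (hochschildD k A (TrivialLeft ε A) 0 x) = 0 := by
  refine LinearMap.congr_fun (f := chainAugmentation k A ε ∘ₗ hochschildD k A (TrivialLeft ε A) 0)
    (g := 0) (chain_hom_ext fun m a => ?_) x
  obtain ⟨m, rfl⟩ := (toTrivialLeft ε A).surjective m
  have e0 : faceHead (0 : Fin 2) (toTrivialLeft ε A m) a = toTrivialLeft ε A (m * a 0) := rfl
  have e1 : faceHead (1 : Fin 2) (toTrivialLeft ε A m) a = toTrivialLeft ε A (ε (a 0) • m) := rfl
  rw [LinearMap.comp_apply, hochschildD_apply, Fin.sum_univ_two, face_tmul_tprod, face_tmul_tprod,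
    e0, e1, map_add, map_zsmul, map_zsmul, chainAugmentation_tprod, chainAugmentation_tprod,
    map_mul, map_smul, smul_eq_mul, mul_comm]
  simp

/-- In degree 0 the face d₁h has nothing to commute with: it applies ε to the coefficient and leaves
1 behind. -/
theorem hochschildD_barHomotopy_zero (x : HochschildChain k A (TrivialLeft ε A) 0) :
    hochschildD k A (TrivialLeft ε A) 0 (barHomotopy ε 0 x) =
      x - chainAugmentation k A ε x • (toTrivialLeft ε A 1 ⊗ₜ PiTensorProduct.tprod k Fin.elim0) := by
  have h : face k A (TrivialLeft ε A) 1 ∘ₗ barHomotopy ε 0 =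
      (chainAugmentation k A ε).smulRight
        (toTrivialLeft ε A 1 ⊗ₜ PiTensorProduct.tprod k (Fin.elim0 : Fin 0 → A)) := by
    refine chain_hom_ext fun m a => ?_
    obtain ⟨m, rfl⟩ := (toTrivialLeft ε A).surjective m
    have e1 : faceHead (1 : Fin 2) (toTrivialLeft ε A 1) (Fin.cons m a : Fin 1 → A) =
      ε m • toTrivialLeft ε A 1 := rfl
    rw [LinearMap.comp_apply, barHomotopy_tmul, face_tmul_tprod, LinearMap.smulRight_apply, e1,
      chainAugmentation_tprod, TensorProduct.smul_tmul',
      Subsingleton.elim (faceTail 1 (Fin.cons m a : Fin 1 → A)) Fin.elim0]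
  have h1 := LinearMap.congr_fun h x
  rw [LinearMap.comp_apply, LinearMap.smulRight_apply] at h1
  rw [hochschildD_apply, Fin.sum_univ_two, face_zero_barHomotopy, h1, sub_eq_add_neg]
  simp

/-- The augmentation of the bar complex. -/
def barAugmentation : BarModule ε 0 →ₗ[A] TrivialModule ε where
  toFun x := chainAugmentation k A ε ((toBar ε 0).symm x)
  map_add' x y := (congrArg _ (map_add (toBar ε 0).symm x y)).trans (map_add _ _ _)
  map_smul' a x := chainAugmentation_leftMul ε a ((toBar ε 0).symm x)

theorem barAugmentation_surjective : Function.Surjective (barAugmentation ε) := fun c =>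
  ⟨toBar ε 0 (toTrivialLeft ε A (algebraMap k A c) ⊗ₜ PiTensorProduct.tprod k Fin.elim0),
    (chainAugmentation_tprod ε _ _).trans (ε.commutes c)⟩

theorem exists_barD_of_barAugmentation_eq_zero (x : BarModule ε 0)
    (hx : barAugmentation ε x = 0) : ∃ y, barD ε 0 y = x := by
  obtain ⟨x, rfl⟩ := (toBar ε 0).surjective x
  have hx' : chainAugmentation k A ε x = 0 := hx
  refine ⟨toBar ε 1 (barHomotopy ε 0 x), ?_⟩
  rw [barD_toBar, hochschildD_barHomotopy_zero, hx', zero_smul, sub_zero]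

theorem exists_barD_of_barD_eq_zero (n : ℕ) (x : BarModule ε (n + 1)) (hx : barD ε n x = 0) :
    ∃ y, barD ε (n + 1) y = x := by
  obtain ⟨x, rfl⟩ := (toBar ε (n + 1)).surjective x
  rw [barD_toBar, map_eq_zero_iff _ (toBar ε n).injective] at hx
  refine ⟨toBar ε (n + 2) (barHomotopy ε (n + 1) x), ?_⟩
  rw [barD_toBar, hochschildD_barHomotopy, hx, map_zero, sub_zero]

theorem barAugmentation_barD (x : BarModule ε 1) : barAugmentation ε (barD ε 0 x) = 0 := by
  obtain ⟨x, rfl⟩ := (toBar ε 1).surjective x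
  exact chainAugmentation_hochschildD ε x

/-- The bar resolution of the trivial module. -/
def barResolution : ProjectiveResolution (ModuleCat.of A (TrivialModule ε)) :=
  resolutionOfExact (barComplex ε) (ModuleCat.ofHom (barAugmentation ε))
    (fun n => (IsProjective.iff_projective (BarModule ε n)).1 inferInstance)
    (barAugmentation_surjective ε)
    (by
      rw [barComplex_d]
      exact ModuleCat.hom_ext (LinearMap.ext (barAugmentation_barD ε)))
    (by
      rw [barComplex_d]
      exact exists_barD_of_barAugmentation_eq_zero ε)
    (fun n => by
      rw [barComplex_d, barComplex_d]
      exact exists_barD_of_barD_eq_zero ε n)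

end Bar

/-! ### Tensoring the bar resolution gives the Hochschild complex -/

section TensorBar

variable {k A : Type u} [Field k] [Ring A] [Algebra k A] (ε : A →ₐ[k] k)
  (W : Type u) [AddCommGroup W] [Module k W] [Module Aᵐᵒᵖ W] [IsScalarTower k Aᵐᵒᵖ W]

/-- The map of bimodules `a ↦ w a`. -/
def orbitMap : W →ₗ[k] TrivialLeft ε A →ₗ[k] TrivialLeft ε W :=
  LinearMap.mk₂ k
    (fun w a => toTrivialLeft ε W (MulOpposite.op ((toTrivialLeft ε A).symm a) • w))
    (fun w w' a => by rw [smul_add, map_add])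
    (fun c w a => by rw [smul_comm, map_smul])
    (fun w a a' => by rw [map_add, MulOpposite.op_add, add_smul, map_add])
    (fun c w a => by
      rw [map_smul (toTrivialLeft ε A).symm, MulOpposite.op_smul, smul_assoc, map_smul])

theorem orbitMap_apply (w : W) (a : A) :
    orbitMap ε W w (toTrivialLeft ε A a) = toTrivialLeft ε W (MulOpposite.op a • w) := rfl

theorem orbitMap_op_smul (a : A) (w : W) :
    orbitMap ε W (MulOpposite.op a • w) = orbitMap ε W w ∘ₗ leftMul ε a := by
  refine LinearMap.ext fun b => ?_
  obtain ⟨b, rfl⟩ := (toTrivialLeft ε A).surjective b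
  rw [LinearMap.comp_apply, leftMul_apply, orbitMap_apply, orbitMap_apply, MulOpposite.op_mul,
    mul_smul]

/-- The map `W ⊗_A (A ⊗ A ⊗ ⋯ ⊗ A) → W ⊗ A ⊗ ⋯ ⊗ A`. -/
def tensorBarHom (n : ℕ) : BalancedTensor k A W (BarModule ε n) →ₗ[k]
    HochschildChain k A (TrivialLeft ε W) n :=
  BalancedTensor.lift
    { toFun := fun w => AddMonoidHom.toIntLinearMap
        (((orbitMap ε W w).rTensor (PiTensorProduct k (fun _ : Fin n => A))).toAddMonoidHom.comp
          (toBar ε n).symm.toAddMonoidHom)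
      map_add' := fun w w' => LinearMap.ext fun x =>
        (congrArg (fun f => LinearMap.rTensor _ f ((toBar ε n).symm x))
          (map_add (orbitMap ε W) w w')).trans
          (LinearMap.congr_fun (LinearMap.rTensor_add _ _ _) _)
      map_smul' := fun c w => LinearMap.ext fun x =>
        (congrArg (fun f => LinearMap.rTensor _ f ((toBar ε n).symm x))
          (map_smul (orbitMap ε W) c w)).trans
          (LinearMap.congr_fun (LinearMap.rTensor_smul _ _ _) _) }
    (fun w a x => by
      obtain ⟨x, rfl⟩ := (toBar ε n).surjective x
      rw [smul_toBar]
      refine (congrArg (fun f => LinearMap.rTensor _ f x) (orbitMap_op_smul ε W a w)).trans ?_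
      exact LinearMap.rTensor_comp_apply _ _ _ _)

theorem tensorBarHom_tmul (n : ℕ) (w : W) (x : HochschildChain k A (TrivialLeft ε A) n) :
    tensorBarHom ε W n (BalancedTensor.tmul k A w (toBar ε n x)) =
      (orbitMap ε W w).rTensor _ x := rfl

theorem toBar_tmul_smul (n : ℕ) (c : k) (t : PiTensorProduct k (fun _ : Fin n => A)) :
    toBar ε n (toTrivialLeft ε A 1 ⊗ₜ (c • t)) =
      algebraMap k A c • toBar ε n (toTrivialLeft ε A 1 ⊗ₜ t) := by
  rw [smul_toBar, LinearMap.rTensor_tmul, leftMul_apply, mul_one, Algebra.algebraMap_eq_smul_one,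
    map_smul, TensorProduct.smul_tmul]

/-- The map `w ⊗ t ↦ w ⊗ (1 ⊗ t)`. -/
def tensorBarInv (n : ℕ) : HochschildChain k A (TrivialLeft ε W) n →ₗ[k]
    BalancedTensor k A W (BarModule ε n) :=
  TensorProduct.lift (LinearMap.mk₂ k (fun w t => BalancedTensor.tmul k A
      ((toTrivialLeft ε W).symm w) (toBar ε n (toTrivialLeft ε A 1 ⊗ₜ t)))
    (fun w w' t => by rw [map_add, BalancedTensor.add_tmul])
    (fun c w t => by rw [map_smul, BalancedTensor.smul_tmul])
    (fun w t t' => by rw [TensorProduct.tmul_add, map_add, BalancedTensor.tmul_add])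
    (fun c w t => by
      rw [toBar_tmul_smul, ← BalancedTensor.op_smul_tmul, ← BalancedTensor.smul_tmul,
        ← algebraMap_smul Aᵐᵒᵖ c]
      rfl))

theorem tensorBarInv_tmul (n : ℕ) (w : W) (t : PiTensorProduct k (fun _ : Fin n => A)) :
    tensorBarInv ε W n (toTrivialLeft ε W w ⊗ₜ t) =
      BalancedTensor.tmul k A w (toBar ε n (toTrivialLeft ε A 1 ⊗ₜ t)) := rfl

theorem tensorBarInv_tensorBarHom (n : ℕ) (w : W) (x : HochschildChain k A (TrivialLeft ε A) n) :
    tensorBarInv ε W n ((orbitMap ε W w).rTensor _ x) =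
      BalancedTensor.tmul k A w (toBar ε n x) := by
  induction x using TensorProduct.induction_on with
  | zero =>
    rw [map_zero, map_zero, map_zero]
    exact (map_zero (BalancedTensor.tmulHom k A w)).symm
  | tmul a t =>
    obtain ⟨a, rfl⟩ := (toTrivialLeft ε A).surjective a
    rw [LinearMap.rTensor_tmul, orbitMap_apply, tensorBarInv_tmul, BalancedTensor.op_smul_tmul,
      smul_toBar, LinearMap.rTensor_tmul, leftMul_apply, mul_one]
  | add x y hx hy => rw [map_add, map_add, hx, hy, map_add, BalancedTensor.tmul_add]

/-- The isomorphism `W ⊗_A (A ⊗ A ⊗ ⋯ ⊗ A) ≃ W ⊗ A ⊗ ⋯ ⊗ A`. -/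
def tensorBarEquiv (n : ℕ) : BalancedTensor k A W (BarModule ε n) ≃ₗ[k]
    HochschildChain k A (TrivialLeft ε W) n :=
  LinearEquiv.ofLinearMap (tensorBarHom ε W n) (tensorBarInv ε W n)
    (TensorProduct.ext' fun w t => by
      obtain ⟨w, rfl⟩ := (toTrivialLeft ε W).surjective w
      rw [LinearMap.comp_apply, tensorBarInv_tmul, tensorBarHom_tmul, LinearMap.id_apply,
        LinearMap.rTensor_tmul, orbitMap_apply, MulOpposite.op_one, one_smul])
    (BalancedTensor.hom_ext fun w x => by
      obtain ⟨x, rfl⟩ := (toBar ε n).surjective x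
      rw [LinearMap.comp_apply, tensorBarHom_tmul, LinearMap.id_apply, tensorBarInv_tensorBarHom])

theorem tensorBarHom_map_barD (n : ℕ) (z : BalancedTensor k A W (BarModule ε (n + 1))) :
    tensorBarHom ε W n (BalancedTensor.map k W (barD ε n) z) =
      hochschildD k A (TrivialLeft ε W) n (tensorBarHom ε W (n + 1) z) := by
  induction z using BalancedTensor.induction_on with
  | tmul w x =>
    obtain ⟨x, rfl⟩ := (toBar ε (n + 1)).surjective x
    rw [BalancedTensor.map_tmul, barD_toBar, tensorBarHom_tmul, tensorBarHom_tmul,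
      hochschildD_rTensor (orbitMap ε W w) (fun b a => ?_) (fun b a => ?_)]
    · rw [trivialLeft_smul, map_smul, trivialLeft_smul]
    · obtain ⟨a, rfl⟩ := (toTrivialLeft ε A).surjective a
      rw [op_smul_toTrivialLeft, orbitMap_apply, orbitMap_apply, op_smul_toTrivialLeft, ← mul_smul]
      rfl
  | add x y hx hy => simp only [map_add, hx, hy]

/-- The bar resolution computes the Hochschild homology of `TrivialLeft ε W`. -/
def tensorBarIso : ((balancedTensorFunctor k A W).mapHomologicalComplex _).obj (barComplex ε) ≅
    hochschildComplex k A (TrivialLeft ε W) :=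
  HomologicalComplex.Hom.isoOfComponents (fun n => (tensorBarEquiv ε W n).toModuleIso)
    (by
      rintro _ n rfl
      have h : (hochschildComplex k A (TrivialLeft ε W)).d (n + 1) n =
        ModuleCat.ofHom (hochschildD k A (TrivialLeft ε W) n) := ChainComplex.of_d
          (fun n => ModuleCat.of k (HochschildChain k A (TrivialLeft ε W) n))
          (fun n => ModuleCat.ofHom (hochschildD k A (TrivialLeft ε W) n)) n
      rw [h, Functor.mapHomologicalComplex_obj_d, barComplex_d]
      exact ModuleCat.hom_ext (LinearMap.ext fun z => (tensorBarHom_map_barD ε W n z).symm))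

end TensorBar

/-! ### Separating first and second legs of tensors -/

section Shuffle

variable {k A C V : Type u} [Field k] [Ring A] [Algebra k A] [Ring C] [Algebra k C]
  [AddCommGroup V] [Module k V]

/-- Multilinear maps on tensor products agree if they agree on families of pure tensors. -/
theorem multilinear_ext_tmul {n : ℕ} {F G : MultilinearMap k (fun _ : Fin n => A ⊗[k] C) V}
    (h : ∀ (l : Fin n → A) (r : Fin n → C),
      F (fun j => l j ⊗ₜ r j) = G (fun j => l j ⊗ₜ r j)) : F = G := by
  refine MultilinearMap.ext fun c => ?_
  choose S hS using fun j => TensorProduct.exists_finset (c j)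
  obtain rfl : c = fun j => ∑ p ∈ S j, p.1 ⊗ₜ[k] p.2 := funext hS
  rw [MultilinearMap.map_sum_finset, MultilinearMap.map_sum_finset]
  exact Finset.sum_congr rfl fun p _ => h _ _

variable (k A C) in
/-- The map `(x ⊗ y, z ⊗ t) ↦ y z ⊗ (x ⊗ t)`. -/
def shuffleStep (n : ℕ) : A ⊗[k] C →ₗ[k] C ⊗[k] PiTensorProduct k (fun _ : Fin n => A) →ₗ[k]
    C ⊗[k] PiTensorProduct k (fun _ : Fin (n + 1) => A) :=
  TensorProduct.lift (LinearMap.compl₁₂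
    (TensorProduct.mapBilinear (.id k) C (PiTensorProduct k (fun _ : Fin n => A)) C
      (PiTensorProduct k (fun _ : Fin (n + 1) => A))).flip
    (TensorProduct.curry (consHom k A n)) (LinearMap.mul k C))

theorem shuffleStep_tmul (n : ℕ) (x : A) (y z : C) (t : PiTensorProduct k (fun _ : Fin n => A)) :
    shuffleStep k A C n (x ⊗ₜ y) (z ⊗ₜ t) = (y * z) ⊗ₜ consHom k A n (x ⊗ₜ t) := rfl

variable (k A C) in
/-- The multilinear map `(x₁ ⊗ y₁, …, xₙ ⊗ yₙ) ↦ y₁ ⋯ yₙ ⊗ (x₁ ⊗ ⋯ ⊗ xₙ)`. -/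
def shuffle : (n : ℕ) → MultilinearMap k (fun _ : Fin n => A ⊗[k] C)
    (C ⊗[k] PiTensorProduct k (fun _ : Fin n => A))
  | 0 => MultilinearMap.constOfIsEmpty k _ (1 ⊗ₜ PiTensorProduct.tprod k Fin.elim0)
  | n + 1 => LinearMap.uncurryLeft
      { toFun := fun b => (shuffleStep k A C n b).compMultilinearMap (shuffle n)
        map_add' := fun b b' => MultilinearMap.ext fun c => by simp
        map_smul' := fun x b => MultilinearMap.ext fun c => by simp }

theorem shuffle_tmul (n : ℕ) (l : Fin n → A) (r : Fin n → C) :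
    shuffle k A C n (fun j => l j ⊗ₜ r j) =
      (List.ofFn r).prod ⊗ₜ PiTensorProduct.tprod k l := by
  induction n with
  | zero =>
    rw [Subsingleton.elim l Fin.elim0]
    simp [shuffle]
  | succ n ih =>
    have h : shuffle k A C (n + 1) (fun j => l j ⊗ₜ r j) = shuffleStep k A C n (l 0 ⊗ₜ r 0)
        (shuffle k A C n (fun j => l j.succ ⊗ₜ r j.succ)) := rfl
    rw [h, ih (fun j => l j.succ) (fun j => r j.succ), shuffleStep_tmul, consHom_tmul,
      List.ofFn_succ, List.prod_cons]
    congr 2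
    exact Fin.cons_self_tail l

theorem shuffle_map {C' : Type u} [Ring C'] [Algebra k C'] (φ : C →ₐ[k] C') (n : ℕ)
    (c : Fin n → A ⊗[k] C) :
    shuffle k A C' n (fun j => φ.toLinearMap.lTensor A (c j)) =
      φ.toLinearMap.rTensor _ (shuffle k A C n c) := by
  refine congrArg (fun F : MultilinearMap k (fun _ : Fin n => A ⊗[k] C) _ => F c)
    (multilinear_ext_tmul (F := (shuffle k A C' n).compLinearMap
      fun _ => φ.toLinearMap.lTensor A)
      (G := (φ.toLinearMap.rTensor _).compMultilinearMap (shuffle k A C n)) fun l r => ?_)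
  simp only [MultilinearMap.compLinearMap_apply, LinearMap.compMultilinearMap_apply,
    LinearMap.lTensor_tmul, LinearMap.rTensor_tmul, shuffle_tmul, AlgHom.toLinearMap_apply,
    map_list_prod, List.map_ofFn]
  rfl

end Shuffle

section FaceShuffle

/-- Merging neighbours keeps the product, and the factor dropped by the last face returns on the
right through the head. Face 0 is excluded because its factor would have to return on the left. -/
theorem list_prod_faceTail {A : Type u} [Ring A] {n : ℕ} (i : Fin (n + 2)) (hi : (i : ℕ) ≠ 0)
    (r : Fin (n + 1) → A) :
    (List.ofFn (faceTail i r)).prod * faceHead i 1 r = (List.ofFn r).prod := by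
  induction n with
  | zero =>
    have : (i : ℕ) = 1 := by omega
    simp [faceHead, this]
  | succ n ih =>
    obtain ⟨x, r, rfl⟩ : ∃ x r', r = Fin.cons x r' := ⟨r 0, Fin.tail r, (Fin.cons_self_tail r).symm⟩
    obtain ⟨j, rfl⟩ : ∃ j : Fin (n + 2), i = j.succ :=
      ⟨i.pred (fun h => hi (by rw [h]; rfl)), (Fin.succ_pred _ _).symm⟩
    by_cases hj : (j : ℕ) = 0
    · rw [faceTail_succ_cons j x (x * r 0) r (fun _ => rfl) (fun h => absurd hj h)]
      have h1 : faceTail j r = fun l => r l.succ := by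
        funext l
        simp [faceTail, hj]
      have h2 : faceHead j.succ (1 : A) (Fin.cons x r : Fin (n + 2) → A) = 1 := by
        simp [faceHead, hj]
      rw [h1, h2, List.ofFn_cons, List.ofFn_cons, List.ofFn_succ (f := r)]
      simp [mul_assoc]
    · rw [faceTail_succ_cons j x x r (fun h => absurd h hj) (fun _ => rfl)]
      have h2 : faceHead j.succ (1 : A) (Fin.cons x r : Fin (n + 2) → A) = faceHead j 1 r := by
        simp [faceHead, hj, ← Fin.succ_last]
      rw [h2, List.ofFn_cons, List.ofFn_cons, List.prod_cons, List.prod_cons, mul_assoc, ih j hj]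

theorem faceTail_map {A B : Type u} [Ring A] [Ring B] (φ : A →+* B) {n : ℕ} (i : Fin (n + 2))
    (a : Fin (n + 1) → A) (j : Fin n) :
    faceTail i (fun l => φ (a l)) j = φ (faceTail i a j) := by
  simp only [faceTail]
  split_ifs <;> simp

variable {k A : Type u} [Field k] [Ring A] [Algebra k A]

theorem faceTail_tmul {n : ℕ} (i : Fin (n + 2)) (l r : Fin (n + 1) → A) (j : Fin n) :
    faceTail i (fun p => l p ⊗ₜ[k] r p) j = faceTail i l j ⊗ₜ faceTail i r j := by
  simp only [faceTail]
  split_ifs <;> simp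

end FaceShuffle

/-! ### The convolution action on Hochschild chains -/

section Twist

variable {k A C M : Type u} [Field k] [Ring A] [Algebra k A] [Ring C] [Algebra k C]
  [AddCommGroup M] [Module k M]

/-- The map `m ⊗ (x₁ ⊗ y₁) ⊗ ⋯ ⊗ (xₙ ⊗ yₙ) ↦ f(y₁ ⋯ yₙ)(m) ⊗ x₁ ⊗ ⋯ ⊗ xₙ`. -/
def spread (f : C →ₗ[k] Module.End k M) (n : ℕ) :
    HochschildChain k (A ⊗[k] C) M n →ₗ[k] HochschildChain k A M n :=
  TensorProduct.lift (LinearMap.lcomp k _ (PiTensorProduct.lift (shuffle k A C n)) ∘ₗ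
    LinearMap.rTensorHom _ ∘ₗ f.flip)

theorem spread_tprod (f : C →ₗ[k] Module.End k M) (n : ℕ) (m : M) (c : Fin n → A ⊗[k] C) :
    spread f n (m ⊗ₜ PiTensorProduct.tprod k c) = (f.flip m).rTensor _ (shuffle k A C n c) := by
  simp [spread]

theorem spread_tmul (f : C →ₗ[k] Module.End k M) (n : ℕ) (m : M) (l : Fin n → A) (r : Fin n → C) :
    spread f n (m ⊗ₜ PiTensorProduct.tprod k fun j => l j ⊗ₜ[k] r j) =
      f (List.ofFn r).prod m ⊗ₜ PiTensorProduct.tprod k l := by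
  rw [spread_tprod, shuffle_tmul, LinearMap.rTensor_tmul, LinearMap.flip_apply]

/-- Linear maps on tensor powers of a tensor product agree if they agree on pure tensors. -/
theorem apply_eq_of_tmul {n : ℕ} {V : Type u} [AddCommGroup V] [Module k V]
    {F G : PiTensorProduct k (fun _ : Fin n => A ⊗[k] C) →ₗ[k] V}
    (h : ∀ (l : Fin n → A) (r : Fin n → C),
      F (PiTensorProduct.tprod k fun j => l j ⊗ₜ r j) =
        G (PiTensorProduct.tprod k fun j => l j ⊗ₜ r j)) (c : Fin n → A ⊗[k] C) :
    F (PiTensorProduct.tprod k c) = G (PiTensorProduct.tprod k c) :=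
  congrArg (fun H : MultilinearMap k (fun _ : Fin n => A ⊗[k] C) V => H c)
    (multilinear_ext_tmul (F := F.compMultilinearMap (PiTensorProduct.tprod k))
      (G := G.compMultilinearMap (PiTensorProduct.tprod k)) h)

end Twist

section TwistCoalgebra

variable {k A C M : Type u} [Field k] [Ring A] [Bialgebra k A] [Ring C] [Algebra k C]
  [AddCommGroup M] [Module k M]

/-- The map `m ⊗ t ↦ ∑ f(t'')(m) ⊗ t'`. -/
def twist (f : A →ₗ[k] Module.End k M) (n : ℕ) :
    HochschildChain k A M n →ₗ[k] HochschildChain k A M n :=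
  spread f n ∘ₗ (PiTensorProduct.map fun _ => Coalgebra.comul).lTensor M

theorem twist_tprod (f : A →ₗ[k] Module.End k M) (n : ℕ) (m : M) (a : Fin n → A) :
    twist f n (m ⊗ₜ PiTensorProduct.tprod k a) =
      spread f n (m ⊗ₜ PiTensorProduct.tprod k fun j => Coalgebra.comul (a j)) := by
  rw [twist, LinearMap.comp_apply, LinearMap.lTensor_tmul, PiTensorProduct.map_tprod]

/-- The map `a ⊗ c ↦ g(a) f(c)`. -/
def mulHom {B : Type u} [AddCommGroup B] [Module k B] (g : B →ₗ[k] Module.End k M)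
    (f : C →ₗ[k] Module.End k M) : B ⊗[k] C →ₗ[k] Module.End k M :=
  LinearMap.mul' k (Module.End k M) ∘ₗ TensorProduct.map g f

theorem mulHom_tmul {B : Type u} [AddCommGroup B] [Module k B] (g : B →ₗ[k] Module.End k M)
    (f : C →ₗ[k] Module.End k M) (b : B) (c : C) (m : M) :
    mulHom g f (b ⊗ₜ c) m = g b (f c m) := rfl

theorem list_prod_tmul (n : ℕ) (x : Fin n → A) (y : Fin n → C) :
    (List.ofFn fun j => x j ⊗ₜ[k] y j).prod = (List.ofFn x).prod ⊗ₜ (List.ofFn y).prod := by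
  induction n with
  | zero => simp [Algebra.TensorProduct.one_def]
  | succ n ih => simp [List.ofFn_succ, ih (fun j => x j.succ) fun j => y j.succ]

theorem spread_mul_apply (g : A →ₗ[k] Module.End k M) (f : C →ₗ[k] Module.End k M) (n : ℕ) (m : M)
    (r : Fin n → C) (d : Fin n → A ⊗[k] A) :
    spread g n (f (List.ofFn r).prod m ⊗ₜ PiTensorProduct.tprod k d) =
      spread (mulHom g f) n (m ⊗ₜ PiTensorProduct.tprod k fun j =>
        TensorProduct.assoc k A A C (d j ⊗ₜ r j)) := by
  refine (apply_eq_of_tmul (F := spread g n ∘ₗ TensorProduct.mk k M _ (f (List.ofFn r).prod m))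
    (G := spread (mulHom g f) n ∘ₗ TensorProduct.mk k M _ m ∘ₗ PiTensorProduct.map (fun j =>
    (TensorProduct.assoc k A A C).toLinearMap ∘ₗ (TensorProduct.mk k (A ⊗[k] A) C).flip (r j)))
    (fun x y => ?_) d).trans
    (congrArg (fun t => spread (mulHom g f) n (m ⊗ₜ t)) (PiTensorProduct.map_tprod _ _))
  simp only [LinearMap.comp_apply, TensorProduct.mk_apply, PiTensorProduct.map_tprod, spread_tmul,
    LinearMap.flip_apply, LinearEquiv.coe_coe, TensorProduct.assoc_tmul, list_prod_tmul,
    mulHom_tmul]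

/-- The operators compose while Δ splits the first legs again, so the new second legs stand to the
left of the old ones. Products of pure tensors are formed factorwise, so f and g need only be
linear. -/
theorem twist_spread (g : A →ₗ[k] Module.End k M) (f : C →ₗ[k] Module.End k M) (n : ℕ) (m : M)
    (c : Fin n → A ⊗[k] C) :
    twist g n (spread f n (m ⊗ₜ PiTensorProduct.tprod k c)) =
      spread (mulHom g f) n (m ⊗ₜ PiTensorProduct.tprod k fun j =>
        TensorProduct.assoc k A A C (Coalgebra.comul.rTensor C (c j))) := by
  refine (apply_eq_of_tmul (F := twist g n ∘ₗ spread f n ∘ₗ TensorProduct.mk k M _ m)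
    (G := spread (mulHom g f) n ∘ₗ TensorProduct.mk k M _ m ∘ₗ PiTensorProduct.map (fun _ =>
    (TensorProduct.assoc k A A C).toLinearMap ∘ₗ Coalgebra.comul.rTensor C)) (fun l r => ?_) c).trans
    (congrArg (fun t => spread (mulHom g f) n (m ⊗ₜ t)) (PiTensorProduct.map_tprod _ _))
  simp only [LinearMap.comp_apply, TensorProduct.mk_apply, PiTensorProduct.map_tprod, spread_tmul,
    twist_tprod, LinearMap.rTensor_tmul]
  exact spread_mul_apply g f n m r fun j => Coalgebra.comul (l j)

theorem spread_map {C' : Type u} [Ring C'] [Algebra k C'] (f : C' →ₗ[k] Module.End k M)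
    (φ : C →ₐ[k] C') (n : ℕ) (m : M) (c : Fin n → A ⊗[k] C) :
    spread f n (m ⊗ₜ PiTensorProduct.tprod k fun j => φ.toLinearMap.lTensor A (c j)) =
      spread (f ∘ₗ φ.toLinearMap) n (m ⊗ₜ PiTensorProduct.tprod k c) := by
  rw [spread_tprod, spread_tprod, shuffle_map, ← LinearMap.rTensor_comp_apply]
  rfl

/-- Twisting turns convolution of linear maps A → End M into composition. Coassociativity regroups
the legs entry by entry, and multiplicativity of Δ allows the second legs to be multiplied before
they are split. -/
theorem twist_twist (g f : A →ₗ[k] Module.End k M) (n : ℕ) (x : HochschildChain k A M n) :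
    twist g n (twist f n x) = twist (mulHom g f ∘ₗ Coalgebra.comul) n x := by
  refine LinearMap.congr_fun (f := twist g n ∘ₗ twist f n) (chain_hom_ext fun m a => ?_) x
  rw [LinearMap.comp_apply, twist_tprod, twist_spread, twist_tprod]
  refine Eq.trans ?_ (spread_map (mulHom g f) (Bialgebra.comulAlgHom k A) n m _)
  congr 3
  funext j
  exact Coalgebra.coassoc_apply (a j)

theorem twist_counit (n : ℕ) (x : HochschildChain k A M n) :
    twist (Algebra.linearMap k (Module.End k M) ∘ₗ Coalgebra.counit) n x = x := by
  refine LinearMap.congr_fun (g := LinearMap.id) (chain_hom_ext fun m a => ?_) x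
  rw [twist_tprod]
  refine (spread_map (Algebra.linearMap k (Module.End k M)) (Bialgebra.counitAlgHom k A) n m _).symm.trans ?_
  have h (j) : (Bialgebra.counitAlgHom k A).toLinearMap.lTensor A (Coalgebra.comul (a j)) =
    a j ⊗ₜ[k] (1 : k) := Coalgebra.lTensor_counit_comul (a j)
  simp only [h]
  rw [spread_tmul, List.ofFn_const, List.prod_replicate, one_pow]
  simp

end TwistCoalgebra

theorem faceHead_smul {A M : Type u} [Ring A] [AddCommGroup M] [Module A M] [Module Aᵐᵒᵖ M]
    {n : ℕ} (i : Fin (n + 2)) (hi : (i : ℕ) ≠ 0) (m : M)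
    (a : Fin (n + 1) → A) : faceHead i m a = faceHead i (1 : A) a • m := by
  simp only [faceHead, hi, if_false]
  split_ifs <;> simp

/-! ### Untwisting the coefficients into the right adjoint module -/

section AdjointModule

variable (k A M : Type u) [Field k] [Ring A] [HopfAlgebra k A] [AddCommGroup M] [Module k M]

instance : Module k (RightAdjoint k A M) := inferInstanceAs (Module k M)

/-- The identity map from a bimodule to its right adjoint module. -/
def toRightAdjoint : M ≃ₗ[k] RightAdjoint k A M := LinearEquiv.refl k M

/-- The bimodule with the right adjoint action and the trivial left action. -/
abbrev AdjointBimodule : Type u :=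
  TrivialLeft (Bialgebra.counitAlgHom k A) (RightAdjoint k A M)

/-- The identity map from `M` to `AdjointBimodule k A M`. -/
def toAdjoint : M ≃ₗ[k] AdjointBimodule k A M :=
  (toRightAdjoint k A M).trans (toTrivialLeft (Bialgebra.counitAlgHom k A) _)

theorem smul_toAdjoint (a : A) (m : M) :
    a • toAdjoint k A M m = toAdjoint k A M (Coalgebra.counit (R := k) a • m) := rfl

section RightAction

variable [Module Aᵐᵒᵖ M] [IsScalarTower k Aᵐᵒᵖ M]

/-- The right action of `A` on `M`. -/
def rightAct : A →ₗ[k] Module.End k M :=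
  (Algebra.lsmul k k M : Aᵐᵒᵖ →ₐ[k] _).toLinearMap ∘ₗ (MulOpposite.opLinearEquiv k).toLinearMap

theorem rightAct_apply (a : A) (m : M) : rightAct k A M a m = MulOpposite.op a • m := rfl

end RightAction

section LeftAction

variable [Module A M] [IsScalarTower k A M]

/-- The left action of `A` on `M`. -/
def leftAct : A →ₗ[k] Module.End k M := (Algebra.lsmul k k M : A →ₐ[k] _).toLinearMap

theorem leftAct_apply (a : A) (m : M) : leftAct k A M a m = a • m := rfl

/-- The antipode axiom S * id = ε, pushed through the left action: a one-sided convolution inverse.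
The next lemma is the other side, and together they invert the twist. -/
theorem mulHom_antipode_leftAct :
    mulHom (leftAct k A M ∘ₗ HopfAlgebra.antipode k) (leftAct k A M) ∘ₗ Coalgebra.comul =
      Algebra.linearMap k (Module.End k M) ∘ₗ Coalgebra.counit := by
  have h : mulHom (leftAct k A M ∘ₗ HopfAlgebra.antipode k) (leftAct k A M) =
      leftAct k A M ∘ₗ LinearMap.mul' k A ∘ₗ (HopfAlgebra.antipode k).rTensor A :=
    TensorProduct.ext' fun a b => LinearMap.ext fun m => (mul_smul _ _ _).symm
  rw [h, LinearMap.comp_assoc, LinearMap.comp_assoc, HopfAlgebra.mul_antipode_rTensor_comul]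
  exact LinearMap.ext fun a => LinearMap.ext fun m => algebraMap_smul A _ m

theorem mulHom_leftAct_antipode :
    mulHom (leftAct k A M) (leftAct k A M ∘ₗ HopfAlgebra.antipode k) ∘ₗ Coalgebra.comul =
      Algebra.linearMap k (Module.End k M) ∘ₗ Coalgebra.counit := by
  have h : mulHom (leftAct k A M) (leftAct k A M ∘ₗ HopfAlgebra.antipode k) =
      leftAct k A M ∘ₗ LinearMap.mul' k A ∘ₗ (HopfAlgebra.antipode k).lTensor A :=
    TensorProduct.ext' fun a b => LinearMap.ext fun m => (mul_smul _ _ _).symm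
  rw [h, LinearMap.comp_assoc, LinearMap.comp_assoc, HopfAlgebra.mul_antipode_lTensor_comul]
  exact LinearMap.ext fun a => LinearMap.ext fun m => algebraMap_smul A _ m

/-- The automorphism `m ⊗ t ↦ ∑ t'' m ⊗ t'` of the space of Hochschild chains. -/
def twistAut (n : ℕ) : HochschildChain k A M n ≃ₗ[k] HochschildChain k A M n :=
  LinearEquiv.ofLinearMap (twist (leftAct k A M) n)
    (twist (leftAct k A M ∘ₗ HopfAlgebra.antipode k) n)
    (LinearMap.ext fun x => by
      rw [LinearMap.comp_apply, twist_twist, mulHom_leftAct_antipode, twist_counit,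
        LinearMap.id_apply])
    (LinearMap.ext fun x => by
      rw [LinearMap.comp_apply, twist_twist, mulHom_antipode_leftAct, twist_counit,
        LinearMap.id_apply])

/-- The isomorphism `m ⊗ t ↦ ∑ t'' m ⊗ t'` of spaces of Hochschild chains. -/
def twistEquiv (n : ℕ) :
    HochschildChain k A M n ≃ₗ[k] HochschildChain k A (AdjointBimodule k A M) n :=
  (twistAut k A M n).trans (LinearEquiv.rTensor _ (toAdjoint k A M))

theorem twistEquiv_apply (n : ℕ) (x : HochschildChain k A M n) :
    twistEquiv k A M n x = (toAdjoint k A M).toLinearMap.rTensor _ (twist (leftAct k A M) n x) :=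
  rfl

end LeftAction

variable [Module A M] [Module Aᵐᵒᵖ M] [IsScalarTower k A M] [IsScalarTower k Aᵐᵒᵖ M]
  [SMulCommClass A Aᵐᵒᵖ M]

theorem op_smul_toRightAdjoint (a : Aᵐᵒᵖ) (m : M) :
    a • toRightAdjoint k A M m = toRightAdjoint k A M (adjointHom k A M a m) := rfl

instance : IsScalarTower k Aᵐᵒᵖ (RightAdjoint k A M) where
  smul_assoc c a m := by
    obtain ⟨m, rfl⟩ := (toRightAdjoint k A M).surjective m
    rw [op_smul_toRightAdjoint, op_smul_toRightAdjoint, map_smul, LinearMap.smul_apply, map_smul]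

/-- The right adjoint action of `A` on `M`. -/
def adjointAct : A →ₗ[k] Module.End k M :=
  (adjointHom k A M).toLinearMap ∘ₗ (MulOpposite.opLinearEquiv k).toLinearMap

/-- The map `b ⊗ c ↦ (m ↦ S(c) m b)`. -/
def adjointAuxLinear : A ⊗[k] A →ₗ[k] Module.End k M :=
  (MulOpposite.opLinearEquiv k).symm.toLinearMap ∘ₗ (adjointAux k A M).toLinearMap

theorem adjointAuxLinear_tmul (b c : A) (m : M) :
    adjointAuxLinear k A M (b ⊗ₜ c) m = HopfAlgebra.antipode k c • MulOpposite.op b • m := by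
  simp only [adjointAuxLinear, adjointAux, LinearMap.comp_apply, AlgHom.toLinearMap_apply]
  rfl

/-- The identity `∑ S(a₂) a₃ m a₁ = m a`. -/
theorem mulHom_adjointAct_comul (a : A) :
    mulHom (adjointAct k A M) (leftAct k A M) (Coalgebra.comul a) = rightAct k A M a := by
  have h1 : mulHom (adjointAct k A M) (leftAct k A M) =
      mulHom (adjointAuxLinear k A M) (leftAct k A M) ∘ₗ Coalgebra.comul.rTensor A :=
    TensorProduct.ext' fun _ _ => rfl
  have h2 : mulHom (adjointAuxLinear k A M) (leftAct k A M) =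
      mulHom (rightAct k A M) (leftAct k A M) ∘ₗ
        ((LinearMap.mul' k A ∘ₗ (HopfAlgebra.antipode k).rTensor A).lTensor A) ∘ₗ
        (TensorProduct.assoc k A A A).toLinearMap := by
    refine TensorProduct.ext_threefold fun b c r => LinearMap.ext fun m => ?_
    rw [mulHom_tmul, adjointAuxLinear_tmul, leftAct_apply]
    simp only [LinearMap.comp_apply, LinearEquiv.coe_coe, TensorProduct.assoc_tmul,
      LinearMap.lTensor_tmul, LinearMap.rTensor_tmul, LinearMap.mul'_apply]
    rw [mulHom_tmul, rightAct_apply, leftAct_apply, mul_smul,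
      smul_comm (HopfAlgebra.antipode k c) (MulOpposite.op b)]
  have h3 : LinearMap.mul' k A ∘ₗ (HopfAlgebra.antipode k).rTensor A ∘ₗ Coalgebra.comul =
    Algebra.linearMap k A ∘ₗ Coalgebra.counit := HopfAlgebra.mul_antipode_rTensor_comul
  rw [h1, h2]
  simp only [LinearMap.comp_apply, LinearEquiv.coe_coe]
  rw [Coalgebra.coassoc_apply, ← LinearMap.lTensor_comp_apply, LinearMap.comp_assoc, h3,
    LinearMap.lTensor_comp_apply, Coalgebra.lTensor_counit_comul, LinearMap.lTensor_tmul]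
  refine LinearMap.ext fun m => ?_
  rw [mulHom_tmul, leftAct_apply, Algebra.linearMap_apply, map_one, one_smul]

theorem op_smul_toAdjoint (a : A) (m : M) :
    MulOpposite.op a • toAdjoint k A M m = toAdjoint k A M (adjointAct k A M a m) := rfl

/-- The map `x ⊗ y ↦ ε(x) y`. -/
def counitLeft : A ⊗[k] A →ₗ[k] A :=
  (TensorProduct.lid k A).toLinearMap ∘ₗ Coalgebra.counit.rTensor A

theorem counitLeft_tmul (x y : A) :
    counitLeft k A (x ⊗ₜ y) = Coalgebra.counit (R := k) x • y := rfl

theorem counitLeft_comul (a : A) : counitLeft k A (Coalgebra.comul a) = a := by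
  rw [counitLeft, LinearMap.comp_apply, Coalgebra.rTensor_counit_comul, LinearEquiv.coe_coe,
    TensorProduct.lid_tmul, one_smul]

variable {k A M}

theorem faceHead_tmul {n : ℕ} (i : Fin (n + 2)) (hi : (i : ℕ) ≠ 0) (l r : Fin (n + 1) → A) :
    faceHead i (1 : A ⊗[k] A) (fun j => l j ⊗ₜ[k] r j) = faceHead i (1 : A) l ⊗ₜ faceHead i (1 : A) r := by
  simp only [faceHead, hi, if_false]
  split_ifs <;> simp [Algebra.TensorProduct.one_def]

/-- Away from face 0 the product of second legs survives, except that the last face removes its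
rightmost factor. That factor is moved onto m, weighted by ε of the matching first leg, which is how
the trivial left action sees it. -/
theorem face_spread {n : ℕ} (i : Fin (n + 2)) (hi : (i : ℕ) ≠ 0) (m : M)
    (c : Fin (n + 1) → A ⊗[k] A) :
    face k A (AdjointBimodule k A M) i ((toAdjoint k A M).toLinearMap.rTensor _
        (spread (leftAct k A M) (n + 1) (m ⊗ₜ PiTensorProduct.tprod k c))) =
      (toAdjoint k A M).toLinearMap.rTensor _ (spread (leftAct k A M) n
        ((counitLeft k A (faceHead i 1 c) • m) ⊗ₜ PiTensorProduct.tprod k (faceTail i c))) := by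
  refine (apply_eq_of_tmul
    (F := face k A (AdjointBimodule k A M) i ∘ₗ (toAdjoint k A M).toLinearMap.rTensor _ ∘ₗ
      spread (leftAct k A M) (n + 1) ∘ₗ TensorProduct.mk k M _ m)
    (G := (toAdjoint k A M).toLinearMap.rTensor _ ∘ₗ spread (leftAct k A M) n ∘ₗ
      ((leftAct k A M).flip m ∘ₗ counitLeft k A).rTensor _ ∘ₗ
      PiTensorProduct.lift (faceMultilinear k (A ⊗[k] A) (A ⊗[k] A) i 1)) (fun l r => ?_) c).trans
    (by
      simp only [LinearMap.comp_apply, PiTensorProduct.lift.tprod]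
      rfl)
  simp only [LinearMap.comp_apply, PiTensorProduct.lift.tprod, TensorProduct.mk_apply, spread_tmul,
    LinearMap.rTensor_tmul, LinearEquiv.coe_coe]
  rw [show faceMultilinear k (A ⊗[k] A) (A ⊗[k] A) i 1 (fun j => l j ⊗ₜ r j) =
    (faceHead i (1 : A) l ⊗ₜ[k] faceHead i (1 : A) r) ⊗ₜ
      PiTensorProduct.tprod k (fun j => faceTail i l j ⊗ₜ[k] faceTail i r j) by
    rw [← faceHead_tmul i hi, ← funext (faceTail_tmul i l r)]; rfl]
  rw [LinearMap.rTensor_tmul, spread_tmul, LinearMap.rTensor_tmul, face_tmul_tprod,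
    LinearMap.comp_apply, counitLeft_tmul, LinearMap.flip_apply, leftAct_apply, leftAct_apply,
    leftAct_apply, faceHead_smul i hi, smul_toAdjoint, LinearEquiv.coe_coe, smul_assoc,
    smul_comm (List.ofFn (faceTail i r)).prod, ← mul_smul (List.ofFn (faceTail i r)).prod,
    list_prod_faceTail i hi]

/-- Face 0 lets the first leg x of the first entry act by the adjoint action on y y₂⋯yₙ m, where y
is its second leg. So the entry acts as a whole, after the other entries have been spread. -/
theorem face_zero_spread {n : ℕ} (m : M) (c : Fin (n + 1) → A ⊗[k] A) :
    face k A (AdjointBimodule k A M) 0 ((toAdjoint k A M).toLinearMap.rTensor _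
        (spread (leftAct k A M) (n + 1) (m ⊗ₜ PiTensorProduct.tprod k c))) =
      (toAdjoint k A M).toLinearMap.rTensor _
        ((mulHom (adjointAct k A M) (leftAct k A M) (c 0)).rTensor _
          (spread (leftAct k A M) n (m ⊗ₜ PiTensorProduct.tprod k (faceTail 0 c)))) := by
  refine (apply_eq_of_tmul
    (F := face k A (AdjointBimodule k A M) 0 ∘ₗ (toAdjoint k A M).toLinearMap.rTensor _ ∘ₗ
      spread (leftAct k A M) (n + 1) ∘ₗ TensorProduct.mk k M _ m)
    (G := (toAdjoint k A M).toLinearMap.rTensor _ ∘ₗ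
      TensorProduct.lift (LinearMap.lcomp k _ (spread (leftAct k A M) n ∘ₗ
        TensorProduct.mk k M _ m) ∘ₗ LinearMap.rTensorHom _ ∘ₗ
        mulHom (adjointAct k A M) (leftAct k A M)) ∘ₗ
      PiTensorProduct.lift (faceMultilinear k (A ⊗[k] A) (A ⊗[k] A) 0 1)) (fun l r => ?_) c).trans
    (by
      simp only [LinearMap.comp_apply, PiTensorProduct.lift.tprod]
      rw [show faceMultilinear k (A ⊗[k] A) (A ⊗[k] A) 0 1 c =
        c 0 ⊗ₜ PiTensorProduct.tprod k (faceTail 0 c) by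
        refine congrArg (fun b => b ⊗ₜ PiTensorProduct.tprod k (faceTail 0 c)) (one_mul (c 0))]
      rfl)
  simp only [LinearMap.comp_apply, PiTensorProduct.lift.tprod, TensorProduct.mk_apply, spread_tmul,
    LinearMap.rTensor_tmul, LinearEquiv.coe_coe]
  rw [show faceMultilinear k (A ⊗[k] A) (A ⊗[k] A) 0 1 (fun j => l j ⊗ₜ r j) =
    (l 0 ⊗ₜ[k] r 0) ⊗ₜ
      PiTensorProduct.tprod k (fun j => faceTail 0 l j ⊗ₜ[k] faceTail 0 r j) by
    rw [← funext (faceTail_tmul 0 l r)]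
    exact congrArg (fun b => b ⊗ₜ PiTensorProduct.tprod k _) (one_mul (l 0 ⊗ₜ[k] r 0))]
  rw [TensorProduct.lift.tmul]
  simp only [LinearMap.comp_apply, LinearMap.lcomp_apply, TensorProduct.mk_apply, spread_tmul,
    LinearMap.coe_rTensorHom, LinearMap.rTensor_tmul, LinearEquiv.coe_coe, mulHom_tmul,
    face_tmul_tprod]
  congr 1
  have h : faceHead 0 (toAdjoint k A M (leftAct k A M (List.ofFn r).prod m)) l =
    MulOpposite.op (l 0) • toAdjoint k A M (leftAct k A M (List.ofFn r).prod m) := rfl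
  rw [h, op_smul_toAdjoint, List.ofFn_succ, List.prod_cons, leftAct_apply, mul_smul]
  rfl

theorem rightAct_spread (n : ℕ) (a : A) (x : HochschildChain k (A ⊗[k] A) M n) :
    (rightAct k A M a).rTensor _ (spread (leftAct k A M) n x) =
      spread (leftAct k A M) n ((rightAct k A M a).rTensor _ x) := by
  refine LinearMap.congr_fun (f := (rightAct k A M a).rTensor _ ∘ₗ spread (leftAct k A M) n)
    (g := spread (leftAct k A M) n ∘ₗ (rightAct k A M a).rTensor _)
    (chain_hom_ext fun m c => ?_) x
  rw [LinearMap.comp_apply, LinearMap.comp_apply, LinearMap.rTensor_tmul, spread_tprod,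
    spread_tprod, ← LinearMap.rTensor_comp_apply]
  congr 2
  exact LinearMap.ext fun b => (smul_comm b (MulOpposite.op a) m).symm

/-- Face 0 reduces to ∑ S(a₂)a₃ m a₁ = m a and the commutation of left and right actions; the other
faces use that Δ is multiplicative, and the last one also the counit axiom. -/
theorem face_twistEquiv (n : ℕ) (i : Fin (n + 2)) (x : HochschildChain k A M (n + 1)) :
    face k A (AdjointBimodule k A M) i (twistEquiv k A M (n + 1) x) =
      twistEquiv k A M n (face k A M i x) := by
  refine LinearMap.congr_fun
    (f := face k A (AdjointBimodule k A M) i ∘ₗ (twistEquiv k A M (n + 1)).toLinearMap)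
    (g := (twistEquiv k A M n).toLinearMap ∘ₗ face k A M i) (chain_hom_ext fun m a => ?_) x
  have hΔ : (fun j => Coalgebra.comul (R := k) (faceTail i a j)) =
      faceTail i (fun j => Coalgebra.comul (R := k) (a j)) := 
    funext fun j => (faceTail_map (Bialgebra.comulAlgHom k A).toRingHom i a j).symm
  rw [LinearMap.comp_apply, LinearMap.comp_apply, LinearEquiv.coe_coe, LinearEquiv.coe_coe,
    twistEquiv_apply, twistEquiv_apply, face_tmul_tprod, twist_tprod, twist_tprod, hΔ]
  by_cases hi : (i : ℕ) = 0
  · obtain rfl : i = 0 := Fin.ext hi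
    rw [face_zero_spread, mulHom_adjointAct_comul, rightAct_spread, LinearMap.rTensor_tmul]
    rfl
  · rw [face_spread i hi, faceHead_smul i hi m a]
    -- Only the left multipliers of m remain: the last face yields ε applied to the first leg of Δ
    -- of the last entry, which is that entry, and inner faces yield 1.
    congr 5
    simp only [faceHead, hi, if_false]
    split_ifs
    · simp [counitLeft_comul]
    · simp [Algebra.TensorProduct.one_def, counitLeft_tmul]

theorem hochschildD_twistEquiv (n : ℕ) (x : HochschildChain k A M (n + 1)) :
    hochschildD k A (AdjointBimodule k A M) n (twistEquiv k A M (n + 1) x) =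
      twistEquiv k A M n (hochschildD k A M n x) := by
  simp only [hochschildD_apply, map_sum, map_zsmul, face_twistEquiv]

variable (k A M)

/-- The Hochschild complex of `M` is isomorphic to that of the right adjoint module of `M`, with the
trivial left action. -/
def twistIso : hochschildComplex k A M ≅ hochschildComplex k A (AdjointBimodule k A M) :=
  HomologicalComplex.Hom.isoOfComponents (fun n => (twistEquiv k A M n).toModuleIso)
    (by
      rintro _ n rfl
      have h (N : Type u) [AddCommGroup N] [Module k N] [Module A N] [Module Aᵐᵒᵖ N]
        [IsScalarTower k A N] [IsScalarTower k Aᵐᵒᵖ N] [SMulCommClass A Aᵐᵒᵖ N] :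
        (hochschildComplex k A N).d (n + 1) n =
        ModuleCat.ofHom (hochschildD k A N n) := ChainComplex.of_d
          (fun n => ModuleCat.of k (HochschildChain k A N n))
          (fun n => ModuleCat.ofHom (hochschildD k A N n)) n
      rw [h, h]
      exact ModuleCat.hom_ext (LinearMap.ext (hochschildD_twistEquiv n)))

end AdjointModule

/-! ### Comparison of resolutions, vanishing ranges and the duality -/

section RangeOfDegrees

variable {k A : Type u} [Field k] [Ring A] [Algebra k A] (ε : A →ₐ[k] k)

theorem finite_trivialModule : Module.Finite A (TrivialModule ε) := by
  refine Module.Finite.of_surjective (LinearMap.toSpanSingleton A (TrivialModule ε) (1 : k))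
    fun c => ⟨algebraMap k A c, ?_⟩
  exact (mul_one (ε (algebraMap k A c))).trans (ε.commutes c)

/-- The trivial module of an AS-regular algebra of global dimension `d` has a resolution of length
`d` by finitely generated projective modules. -/
theorem IsASRegular.exists_resolution {d : ℕ} (hA : IsASRegular ε d) :
    ∃ R : ProjectiveResolution (ModuleCat.of A (TrivialModule ε)),
      (∀ n, d < n → Limits.IsZero (R.complex.X n)) ∧ ∀ n, Module.Finite A (R.complex.X n) := by
  have := hA.noetherian_left
  have hd : HasProjectiveDimensionLE (ModuleCat.of A (TrivialModule ε)) d := by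
    rw [← projectiveDimension_le_iff, ← hA.gldim]
    exact le_iSup (fun X : ModuleCat.{u} A => projectiveDimension X) _
  obtain ⟨C, p, w, h1, h2, h3, h4, h5, h6⟩ :=
    exists_finite_complex d (ModuleCat.of A (TrivialModule ε)) (finite_trivialModule ε) hd
  exact ⟨resolutionOfExact C p h1 h4 w h5 h6, h3, h2⟩

variable (R : ProjectiveResolution (ModuleCat.of A (TrivialModule ε))) {d : ℕ}
  (W : Type u) [AddCommGroup W] [Module k W] [Module Aᵐᵒᵖ W]

theorem isZero_homology_balancedTensor (hR : ∀ n, d < n → Limits.IsZero (R.complex.X n)) (n : ℕ)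
    (hn : d < n) : Limits.IsZero
      ((((balancedTensorFunctor k A W).mapHomologicalComplex _).obj R.complex).homology n) :=
  (HomologicalComplex.exactAt_iff_isZero_homology _ _).1
    (ShortComplex.exact_of_isZero_X₂ _ ((balancedTensorFunctor k A W).map_isZero (hR n hn)))

variable [IsScalarTower k Aᵐᵒᵖ W]

/-- Projective resolutions of the trivial module compute Hochschild homology with coefficients in
a bimodule with trivial left action. -/
def homologyTrivialLeftIso (n : ℕ) : (hochschildComplex k A (TrivialLeft ε W)).homology n ≅
    (((balancedTensorFunctor k A W).mapHomologicalComplex _).obj R.complex).homology n :=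
  (HomologicalComplex.homologyFunctor _ _ n).mapIso (tensorBarIso ε W).symm ≪≫
    -- Both complexes compute the left derived functors of W ⊗_A - at k.
    ((barResolution ε).isoLeftDerivedObj (balancedTensorFunctor k A W) n).symm ≪≫
    R.isoLeftDerivedObj (balancedTensorFunctor k A W) n

/-- The dual resolution of ∫^l has length d: its terms above degree d are duals of cochain terms in
positive degree. -/
theorem subsingleton_ext_leftIntegral (hR : ∀ n, d < n → Limits.IsZero (R.complex.X n))
    (hfin : ∀ n, Module.Finite A (R.complex.X n))
    (hε : ∀ i, i ≠ d → Subsingleton (TrivialExt ε i)) (Y : ModuleCat.{u} Aᵐᵒᵖ) (i : ℕ)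
    (hi : d < i) : Subsingleton (Ext (ModuleCat.of Aᵐᵒᵖ (LeftIntegral ε d)) Y i) := by
  refine subsingleton_of_forall_eq 0 fun e => ?_
  obtain ⟨f, hf, rfl⟩ := (integralResolution ε R hR hfin hε).extMk_surjective e (i + 1) rfl
  have h0 : f = 0 := by
    refine ModuleCat.hom_ext (LinearMap.ext fun x => ?_)
    have hx : x = 0 := congrArg ModuleCat.Hom.hom
      (show ModuleCat.ofHom x = 0 from (CochainComplex.isZero_of_isStrictlyLE R.cochainComplex 0
        ((i : ℤ) - d) (by omega)).eq_of_src _ _)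
    rw [hx, map_zero, map_zero]
  subst h0
  exact ProjectiveResolution.extMk_zero _ _ _

end RangeOfDegrees

/-- Poincaré duality between Hochschild homology and `Ext` out of the homological integral. -/
theorem IsASRegular.nonempty_hochschildHomology_iso {k A : Type u} [Field k] [Ring A]
    [HopfAlgebra k A] {d : ℕ} (hA : IsASRegular (Bialgebra.counitAlgHom k A) d) (M : Type u)
    [AddCommGroup M] [Module k M] [Module A M] [Module Aᵐᵒᵖ M] [IsScalarTower k A M]
    [IsScalarTower k Aᵐᵒᵖ M] [SMulCommClass A Aᵐᵒᵖ M] (i : ℤ) :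
    Nonempty (hochschildHomology k A M ((d : ℤ) - i) ≅
      extModule k (ModuleCat.of Aᵐᵒᵖ (LeftIntegral (Bialgebra.counitAlgHom k A) d))
        (ModuleCat.of Aᵐᵒᵖ (RightAdjoint k A M)) i) := by
  obtain ⟨R, hR, hfin⟩ := hA.exists_resolution
  have hε := hA.left.ext_eq_zero
  have e (n : ℕ) : (hochschildComplex k A M).homology n ≅
      (((balancedTensorFunctor k A (RightAdjoint k A M)).mapHomologicalComplex _).obj
        R.complex).homology n :=
    (HomologicalComplex.homologyFunctor _ _ n).mapIso (twistIso k A M) ≪≫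
      homologyTrivialLeftIso _ R (RightAdjoint k A M) n
  have h0 : Limits.IsZero (ModuleCat.of k PUnit.{u + 1}) :=
    ModuleCat.isZero_of_subsingleton _
  obtain i | i := i
  -- For 0 ≤ i ≤ d the two isomorphisms combine. For i > d the homology is zero by convention and
  -- Ext by the length of the dual resolution; for i < 0 Ext is zero by convention and the homology,
  -- in degree above d, by the length of R.
  · by_cases hi : i ≤ d
    · obtain ⟨n, rfl⟩ := Nat.exists_eq_add_of_le' hi
      have hn : ((n + i : ℕ) : ℤ) - Int.ofNat i = Int.ofNat n := by simp
      rw [hn]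
      obtain ⟨e'⟩ := nonempty_homology_iso_ext _ R (RightAdjoint k A M) hR hfin hε n i rfl
      exact ⟨e n ≪≫ e'⟩
    · obtain ⟨n, rfl⟩ := Nat.exists_eq_add_of_lt (not_le.1 hi)
      have hn : (d : ℤ) - Int.ofNat (d + n + 1) = Int.negSucc n := by
        simp [Int.negSucc_eq]
        ring
      rw [hn]
      have := subsingleton_ext_leftIntegral _ R hR hfin hε
        (ModuleCat.of Aᵐᵒᵖ (RightAdjoint k A M)) (d + n + 1) (by omega)
      exact ⟨h0.iso (ModuleCat.isZero_of_subsingleton (ModuleCat.of k (Ext _ _ (d + n + 1))))⟩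
  · have hn : (d : ℤ) - Int.negSucc i = Int.ofNat (d + i + 1) := by
      simp [Int.negSucc_eq]
      ring
    rw [hn]
    exact ⟨((isZero_homology_balancedTensor _ R _ hR _ (by omega)).of_iso (e _)).iso h0⟩

end HopfDuality

end

theorem corollary3p3 {k A : Type u} [Field k] [Ring A] [HopfAlgebra k A] (d : ℕ)
    (hA : HopfDuality.IsASRegular (Bialgebra.counitAlgHom k A) d) :
    (∀ (M : Type u) [AddCommGroup M] [Module k M] [Module A M] [Module Aᵐᵒᵖ M]
        [IsScalarTower k A M] [IsScalarTower k Aᵐᵒᵖ M] [SMulCommClass A Aᵐᵒᵖ M] (i : ℤ),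
      Nonempty (HopfDuality.hochschildHomology k A M ((d : ℤ) - i) ≅
        HopfDuality.extModule k
          (ModuleCat.of Aᵐᵒᵖ (HopfDuality.LeftIntegral (Bialgebra.counitAlgHom k A) d))
          (ModuleCat.of Aᵐᵒᵖ (HopfDuality.RightAdjoint k A M)) i)) ∧
    (∀ (σ : A ≃ₐ[k] A) (i : ℤ),
      Nonempty (HopfDuality.hochschildHomology k A (HopfDuality.LeftTwist σ A) ((d : ℤ) - i) ≅
        HopfDuality.extModule k
          (ModuleCat.of Aᵐᵒᵖ (HopfDuality.LeftIntegral (Bialgebra.counitAlgHom k A) d))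
          (ModuleCat.of Aᵐᵒᵖ (HopfDuality.RightAdjoint k A (HopfDuality.LeftTwist σ A))) i)) := by
  exact ⟨fun M => hA.nonempty_hochschildHomology_iso M,
    fun σ => hA.nonempty_hochschildHomology_iso (HopfDuality.LeftTwist σ A)⟩
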